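/- Let $K$ be a field of characteristic zero, let $\mathbf m=(m_1,m_2,\dots)$ be a sequence of integers $m_i\ge 2$ and let $k\ge 1$. For $n\ge 0$ put $R_n=K[x_1,\dots,x_n]$, $P_n=(x_1^{m_1},\dots,x_n^{m_n})$ and $I_n=(x_1^{m_1},\dots,x_n^{m_n},(x_1+\cdots+x_n)^k)$, and let $\delta_n$ be the socle degree of $R_n/I_n$, i.e. the largest degree in which $R_n/I_n$ is nonzero (so $\delta_0=0$). Let $G_n$ be the reduced Gröbner basis of $I_n$ with respect to a monomial order with $x_1\succ\cdots\succ x_n$ (for example the degree reverse lexicographic order). Let $\mathrm{HF}(A,e)=\dim_K A_e$, with $\mathrm{HF}(A,e)=0$ for $e<0$. A monomial $s=x_1^{s_1}\cdots x_n^{s_n}$ is called $\mathbf m$-free if $s_i<m_i$ for all $i$. For $1\le j\le n$ let $\overline{\mathrm{Crit}}_{n,j}$ be the set of $\mathbf m$-free monomials $s\in R_n$ such that $s_j>0$ and $$s_j=2(s_1+\cdots+s_j)-k-\sum_{i=1}^{j-1}m_i+(j-1),$$ let $\mathrm{Crit}_{n,j}$ be the set of all $s\in\overline{\mathrm{Crit}}_{n,j}\cap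 K[x_1,\dots,x_j]$ that are not divisible by any element of $\bigcup_{\ell<j}\overline{\mathrm{Crit}}_{n,\ell}$, and let $\mathrm{Crit}_n=\bigcup_{j=1}^n\mathrm{Crit}_{n,j}$. Let $d\ge k$. For an integer $n\ge1$, say that degree $d$ appears at $n$ if there is $g\in G_n$ of degree $d$ whose initial monomial lies in $\mathrm{Crit}_{n,n}$. Then the following hold. (i) There is at most one $n\ge 1$ such that $d$ appears at $n$. Moreover (whether or not $d$ appears at some $n$) the number of elements of degree $d$ in $\mathrm{Crit}_n$ does not depend on $n$ for all sufficiently large $n$; hence its eventual value $g_{\mathbf m,k}(d)$ is well defined. (ii) Suppose that $d$ appears at $n$, let $\epsilon$ be the minimal degree of an element of $\mathrm{Crit}_{n,n}$ and put $\gamma=d-\epsilon$. Then for every $N\ge n$ the number of elements of degree $d$ of $G_N$ with $\mathbf m$-free initial monomial equals $g_{\mathbf m,k}(d)$, and $$g_{\mathbf m,k}(d)=\max\bigl\{0,\ \mathrm{HF}(R_{n-1}/P_{n-1},\,\delta_{n-1}-\gamma)-\mathrm{HF}(R_{n-1}/P_{n-1},\,\delta_{n-1}-\gamma-k)\bigr\}.$$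 -/

import Mathlib

open scoped MonomialOrder

/-! Variables are indexed from zero: `x_{i+1}` is `MvPolynomial.X i` with `i : Fin n`, and an
exponent sequence `(m_1, m_2, …)` is a function `m : ℕ → ℕ` with `m_{i+1} = m i`.
Monomials in `n` variables are exponent vectors `s : Fin n →₀ ℕ`. -/

section Ideals

variable (K : Type*) [Field K]

/-- `P_{n,m} = (x_1^{m_1}, …, x_n^{m_n})`. -/
noncomputable def idealP (m : ℕ → ℕ) (n : ℕ) : Ideal (MvPolynomial (Fin n) K) :=
  Ideal.span (Set.range fun i : Fin n => (MvPolynomial.X i : MvPolynomial (Fin n) K) ^ m i)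

/-- `I_{n,m,k} = (x_1^{m_1}, …, x_n^{m_n}, (x_1 + ⋯ + x_n)^k)`. -/
noncomputable def idealI (m : ℕ → ℕ) (k n : ℕ) : Ideal (MvPolynomial (Fin n) K) :=
  idealP K m n ⊔ Ideal.span {(∑ i : Fin n, (MvPolynomial.X i : MvPolynomial (Fin n) K)) ^ k}

end Ideals

section Hilbert

variable {K : Type*} [Field K] {σ : Type*}

/-- The degree-`d` component `(R/I)_d` of `R/I`: the image of the forms of degree `d`.
(Used for homogeneous ideals `I`.) -/
noncomputable def quotientComponent (I : Ideal (MvPolynomial σ K)) (d : ℕ) :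
    Submodule K (MvPolynomial σ K ⧸ I) :=
  (MvPolynomial.homogeneousSubmodule σ K d).map (Ideal.Quotient.mkₐ K I).toLinearMap

/-- The Hilbert function `HF(R/I, e) = dim_K (R/I)_e`, extended by zero to negative `e`. -/
noncomputable def hilbertFunction (I : Ideal (MvPolynomial σ K)) (e : ℤ) : ℕ :=
  if 0 ≤ e then Module.finrank K (quotientComponent I e.toNat) else 0

/-- The socle degree of an Artinian quotient `R/I`: the largest `d` with `(R/I)_d ≠ 0`. -/
noncomputable def socleDegree (I : Ideal (MvPolynomial σ K)) : ℕ :=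
  sSup {d : ℕ | quotientComponent I d ≠ ⊥}

end Hilbert

section Groebner

variable {K : Type*} [Field K] {σ : Type*}

/-- The initial ideal of `I`, generated by the initial monomials of the nonzero elements. -/
noncomputable def initialIdeal (ord : MonomialOrder σ) (I : Ideal (MvPolynomial σ K)) :
    Ideal (MvPolynomial σ K) :=
  Ideal.span {p | ∃ f ∈ I, f ≠ 0 ∧ p = MvPolynomial.monomial (ord.degree f) 1}

/-- `G` is the reduced Gröbner basis of `I` with respect to `ord`. -/
structure IsReducedGroebnerBasis (ord : MonomialOrder σ) (I : Ideal (MvPolynomial σ K))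
    (G : Finset (MvPolynomial σ K)) : Prop where
  mem : ∀ g ∈ G, g ∈ I ∧ g ≠ 0
  generates : initialIdeal ord I =
    Ideal.span {p | ∃ g ∈ G, p = MvPolynomial.monomial (ord.degree g) 1}
  minimal : ∀ g ∈ G, ∀ h ∈ G, ord.degree h ≤ ord.degree g → h = g
  monic : ∀ g ∈ G, ord.leadingCoeff g = 1
  tail : ∀ g ∈ G, ∀ t ∈ g.support, t ≠ ord.degree g →
    MvPolynomial.monomial t (1 : K) ∉ initialIdeal ord I

end Groebner

section Crit

/-- `s` is `m`-free: `s_i < m_i` for all `i`. -/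
def IsMFree (m : ℕ → ℕ) {n : ℕ} (s : Fin n →₀ ℕ) : Prop := ∀ i : Fin n, s i < m i

/-- The set `\overline{Crit}_{n,m,k,j+1}`: the `m`-free monomials `s` divisible by `x_{j+1}` with
`s_{j+1} = 2 deg(s_{≤ j+1}) - k - ∑_{i=1}^{j} m_i + j`. -/
def critBar (m : ℕ → ℕ) (k n : ℕ) (j : Fin n) : Set (Fin n →₀ ℕ) :=
  {s | IsMFree m s ∧ 0 < s j ∧
    (s j : ℤ) = 2 * (∑ i ∈ Finset.Iic j, (s i : ℤ)) - k
      - (∑ i ∈ Finset.range j, (m i : ℤ)) + (j : ℕ)}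

/-- The set `Crit_{n,m,k,j+1}`: the elements of `\overline{Crit}_{n,m,k,j+1}` that only involve
`x_1, …, x_{j+1}` and are not divisible by any element of `\overline{Crit}_{n,m,k,l+1}`, `l < j`.
These are the monomials whose lattice path is critical at its last edge, with the equality above,
and none of whose shorter initial segments is critical. -/
def critAt (m : ℕ → ℕ) (k n : ℕ) (j : Fin n) : Set (Fin n →₀ ℕ) :=
  {s | s ∈ critBar m k n j ∧ (∀ i, j < i → s i = 0) ∧
    ∀ l, l < j → ∀ t ∈ critBar m k n l, ¬ t ≤ s}

/-- `Crit_{n,m,k}`, the union of the sets `Crit_{n,m,k,j}` for `1 ≤ j ≤ n`. -/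
def crit (m : ℕ → ℕ) (k n : ℕ) : Set (Fin n →₀ ℕ) := ⋃ j, critAt m k n j

/-- The number of elements of degree `d` in `Crit_{n,m,k}`. -/
noncomputable def critCount (m : ℕ → ℕ) (k n d : ℕ) : ℕ :=
  {s | s ∈ crit m k n ∧ s.degree = d}.ncard

/-- `g_{m,k}(d)`: the eventual value of the number of elements of degree `d` in `Crit_{n,m,k}`
as `n → ∞`. -/
noncomputable def gSeq (m : ℕ → ℕ) (k d : ℕ) : ℕ :=
  Filter.limUnder Filter.atTop (fun n => critCount m k n d)

end Crit

/-! Write T_j for `topDegree m j`, with indices from 0. Call an `m`-free monomial standard if s_j +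
2(s_0 + ⋯ + s_{j-1}) < k + T_j for all j; these are the `m`-free monomials without a critical
divisor (`isStandard_iff_forall_crit`). The heart of the proof is that they are exactly the
monomials outside in(I_n) (`monomial_mem_initialIdeal_idealI_iff`). One inclusion is constructive:
each critical monomial leads an element of I_n, built by induction on the number of variables from a
form in x_1 and x_2 + ⋯ + x_n (`exists_mem_idealI_of_mem_critAt`). The other is a count: a recursion
on the last exponent gives max(0, HF(R/P, e) - HF(R/P, e-k)) standard monomials of degree e
(`stdCount_eq_max`), while the multiples of the k-th power of the linear form fill at most HF(R/P,
e-k) dimensions of (R/P)_e (`freeCount_le`). No Lefschetz property is assumed.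

Critical monomials form an antichain, so they are the `m`-free initial monomials of the reduced
basis (`ncard_groebner_eq_critCount`). A critical monomial ending at index j is a standard prefix in
j variables followed by one forced exponent, and its degree d satisfies T_j + k < 2d ≤ T_{j+1} + k.
These intervals are disjoint, so d determines j, which gives (i); the number of such monomials is
the number of standard monomials of degree T_j + k - d in j variables (`ncard_critAt_degree`). When
critical monomials at j exist, the largest prefix degree is the socle degree δ, so ε = T_j + k - δ
and T_j + k - d = δ - γ, which gives (ii). -/

/-! ### Exponent vectors as sequences extended by zero. -/

section PadZero

/-- The extension by zero of an exponent vector to a sequence. -/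
def padZero {n : ℕ} (s : Fin n →₀ ℕ) (i : ℕ) : ℕ := if h : i < n then s ⟨i, h⟩ else 0

/-- The exponent vector of length `n` with the first `n` entries of a sequence. -/
noncomputable def truncVec (n : ℕ) (u : ℕ → ℕ) : Fin n →₀ ℕ :=
  Finsupp.equivFunOnFinite.symm fun i => u i

@[simp] lemma truncVec_apply (n : ℕ) (u : ℕ → ℕ) (i : Fin n) : truncVec n u i = u i := rfl

@[simp] lemma padZero_val {n : ℕ} (s : Fin n →₀ ℕ) (i : Fin n) : padZero s i = s i := by
  simp [padZero]

lemma padZero_of_le {n : ℕ} (s : Fin n →₀ ℕ) {i : ℕ} (h : n ≤ i) : padZero s i = 0 := by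
  simp [padZero, h]

lemma padZero_truncVec (n : ℕ) (u : ℕ → ℕ) (i : ℕ) :
    padZero (truncVec n u) i = if i < n then u i else 0 := by
  by_cases h : i < n <;> simp [padZero, h]

lemma truncVec_padZero {n : ℕ} (s : Fin n →₀ ℕ) : truncVec n (padZero s) = s := by
  ext i; simp

lemma padZero_injective {n : ℕ} : Function.Injective (padZero : (Fin n →₀ ℕ) → ℕ → ℕ) :=
  fun s t h => by rw [← truncVec_padZero s, h, truncVec_padZero]

lemma padZero_mono {n : ℕ} {s t : Fin n →₀ ℕ} (h : s ≤ t) (i : ℕ) : padZero s i ≤ padZero t i := by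
  by_cases hi : i < n
  · simpa [padZero, hi] using h ⟨i, hi⟩
  · simp [padZero, hi]

lemma degree_eq_sum_padZero {n N : ℕ} (s : Fin n →₀ ℕ) (h : n ≤ N) :
    s.degree = ∑ i ∈ Finset.range N, padZero s i := by
  rw [Finsupp.degree_eq_sum, ← Finset.sum_subset (Finset.range_mono h), Finset.sum_range]
  · simp
  · intro i _ hi
    exact padZero_of_le s (by simpa using hi)

lemma sum_Iic_eq_sum_padZero {n : ℕ} (s : Fin n →₀ ℕ) (j : Fin n) :
    ∑ i ∈ Finset.Iic j, (s i : ℤ) = ∑ i ∈ Finset.range (j + 1), (padZero s i : ℤ) := by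
  refine Finset.sum_bij (fun i _ => (i : ℕ)) ?_ ?_ ?_ ?_
  · intro i hi
    simp only [Finset.mem_Iic, Fin.le_def] at hi
    simp; omega
  · intro a _ b _ h
    exact Fin.ext h
  · intro b hb
    simp only [Finset.mem_range] at hb
    exact ⟨⟨b, by omega⟩, by simp [Fin.le_def]; omega, rfl⟩
  · simp

lemma isMFree_iff_padZero {m : ℕ → ℕ} {n : ℕ} {s : Fin n →₀ ℕ} :
    IsMFree m s ↔ ∀ i < n, padZero s i < m i :=
  ⟨fun h i hi => by simpa [padZero, hi] using h ⟨i, hi⟩, fun h i => by simpa using h i i.2⟩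

lemma IsMFree.of_le {m : ℕ → ℕ} {n : ℕ} {s t : Fin n →₀ ℕ} (ht : IsMFree m t) (h : s ≤ t) :
    IsMFree m s := fun i => (h i).trans_lt (ht i)

end PadZero

/-! ### Standard monomials and critical divisors. -/

section Standard

/-- The largest degree `∑_{i < n} (m_i - 1)` of an `m`-free monomial in `n` variables. -/
def topDegree (m : ℕ → ℕ) (n : ℕ) : ℤ := ∑ i ∈ Finset.range n, ((m i : ℤ) - 1)

lemma topDegree_succ (m : ℕ → ℕ) (n : ℕ) : topDegree m (n + 1) = topDegree m n + m n - 1 := by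
  rw [topDegree, Finset.sum_range_succ, ← topDegree]; ring

lemma topDegree_eq (m : ℕ → ℕ) (n : ℕ) :
    topDegree m n = ∑ i ∈ Finset.range n, (m i : ℤ) - n := by
  simp [topDegree, Finset.sum_sub_distrib]

lemma topDegree_strictMono {m : ℕ → ℕ} (hm : ∀ i, 2 ≤ m i) : StrictMono (topDegree m) :=
  strictMono_nat_of_lt_succ fun n => by have := hm n; rw [topDegree_succ]; omega

/-- The `m`-free monomials whose lattice path is not critical anywhere. -/
def IsStandard (m : ℕ → ℕ) (k : ℕ) {n : ℕ} (s : Fin n →₀ ℕ) : Prop :=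
  IsMFree m s ∧ ∀ j < n, (padZero s j : ℤ) + 2 * ∑ i ∈ Finset.range j, (padZero s i : ℤ)
    < k + topDegree m j

lemma mem_critBar_iff {m : ℕ → ℕ} {k n : ℕ} {j : Fin n} {s : Fin n →₀ ℕ} :
    s ∈ critBar m k n j ↔ IsMFree m s ∧ 0 < s j ∧
      (padZero s j : ℤ) + 2 * ∑ i ∈ Finset.range j, (padZero s i : ℤ) = k + topDegree m j := by
  rw [critBar, Set.mem_ofPred_eq, sum_Iic_eq_sum_padZero, Finset.sum_range_succ, topDegree_eq,
    padZero_val]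
  refine and_congr_right fun _ => and_congr_right fun _ => ?_
  constructor <;> intro h <;> linarith

/-- The left side of the inequality is monotone in `s`, so a critical divisor violates it.
Conversely, at the first violation the inequality one index earlier and `m`-freeness bound twice the
partial sum strictly below the threshold, so the current exponent can be lowered to a positive value
attaining equality. -/
lemma forall_not_le_critBar_iff {m : ℕ → ℕ} {k n : ℕ} (hk : 1 ≤ k) {s : Fin n →₀ ℕ}
    (hs : IsMFree m s) (J : ℕ) :
    (∀ l : Fin n, (l : ℕ) < J → ∀ t ∈ critBar m k n l, ¬ t ≤ s) ↔
      ∀ j < n, j < J → (padZero s j : ℤ) + 2 * ∑ i ∈ Finset.range j, (padZero s i : ℤ)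
        < k + topDegree m j := by
  constructor
  · intro h j
    induction j with
    | zero =>
      intro hn hJ
      by_contra! hlt
      simp only [Finset.range_zero, Finset.sum_empty, mul_zero, add_zero, topDegree] at hlt
      -- At the first index the critical divisor is x_1^k.
      refine h ⟨0, hn⟩ hJ (truncVec n (Function.update 0 0 k)) ?_ fun i => ?_
      · rw [mem_critBar_iff]
        refine ⟨isMFree_iff_padZero.2 fun i hi => ?_, ?_, ?_⟩
        · have := isMFree_iff_padZero.1 hs i hi
          rw [padZero_truncVec, if_pos hi]
          rcases Nat.eq_zero_or_pos i with rfl | h0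
          · simp; omega
          · simp [h0.ne']; omega
        · simp; omega
        · simp [padZero_truncVec, hn, topDegree]
      · have : padZero s i = s i := padZero_val s i
        rcases Nat.eq_zero_or_pos (i : ℕ) with h0 | h0
        · rw [h0] at this; simp [h0]; omega
        · simp [h0.ne']
    | succ j ih =>
      intro hn hJ
      have ih := ih (by omega) (by omega)
      by_contra! hlt
      have hmj := isMFree_iff_padZero.1 hs j (by omega)
      have hlow : 2 * ∑ i ∈ Finset.range (j + 1), (padZero s i : ℤ) < k + topDegree m (j + 1) := by
        rw [topDegree_succ, Finset.sum_range_succ]; omega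
      set A := ∑ i ∈ Finset.range (j + 1), (padZero s i : ℤ) with hA
      obtain ⟨b, hb⟩ : ∃ b : ℕ, (b : ℤ) = k + topDegree m (j + 1) - 2 * A :=
        ⟨(k + topDegree m (j + 1) - 2 * A).toNat, Int.toNat_of_nonneg (by omega)⟩
      have hle : ∀ i, (if i < j + 1 then padZero s i else if i = j + 1 then b else 0)
          ≤ padZero s i := by
        intro i
        split_ifs with h1 h2
        · rfl
        · subst h2; omega
        · omega
      set t := truncVec n fun i => if i < j + 1 then padZero s i else if i = j + 1 then b else 0
        with ht
      have hts : t ≤ s := fun i => by rw [ht, truncVec_apply, ← padZero_val s i]; exact hle i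
      have hsum : ∑ i ∈ Finset.range (j + 1), (padZero t i : ℤ) = A := by
        refine Finset.sum_congr rfl fun i hi => ?_
        have hi := Finset.mem_range.1 hi
        rw [ht, padZero_truncVec, if_pos (by omega), if_pos hi]
      refine h ⟨j + 1, hn⟩ hJ t ?_ hts
      rw [mem_critBar_iff]
      refine ⟨hs.of_le hts, ?_, ?_⟩
      · simp [ht]; omega
      · simp only [hsum]
        simp [ht, padZero_truncVec, hn]; omega
  · intro h l hl t ht hts
    have h1 := h l l.2 hl
    have h2 := (mem_critBar_iff.1 ht).2.2
    have h3 := padZero_mono hts l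
    have h4 : ∑ i ∈ Finset.range l, (padZero t i : ℤ) ≤ ∑ i ∈ Finset.range l, (padZero s i : ℤ) :=
      Finset.sum_le_sum fun i _ => by exact_mod_cast padZero_mono hts i
    omega

/-- Descend to the least index at which a critical divisor exists, then delete all later variables;
the equality at that index only sees earlier exponents. -/
lemma exists_mem_critAt_le {m : ℕ → ℕ} {k n : ℕ} {j : Fin n} {t : Fin n →₀ ℕ}
    (ht : t ∈ critBar m k n j) : ∃ l, ∃ u ∈ critAt m k n l, u ≤ t := by
  induction j using WellFoundedLT.induction generalizing t with
  | ind j ih =>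
    by_cases h : ∃ l < j, ∃ u ∈ critBar m k n l, u ≤ t
    · obtain ⟨l, hl, u, hu, hut⟩ := h
      obtain ⟨l', v, hv, hvu⟩ := ih l hl hu
      exact ⟨l', v, hv, hvu.trans hut⟩
    · push Not at h
      set v := truncVec n fun i => if i ≤ j then padZero t i else 0 with hv
      have hvt : v ≤ t := fun i => by
        rw [hv, truncVec_apply]
        split_ifs
        · exact (padZero_val t i).le
        · exact Nat.zero_le _
      refine ⟨j, v, ⟨?_, ?_, fun l hl u hu huv => h l hl u hu (huv.trans hvt)⟩, hvt⟩
      · rw [mem_critBar_iff] at ht ⊢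
        have hp : ∀ i ≤ (j : ℕ), padZero v i = padZero t i := fun i hi => by
          rw [hv, padZero_truncVec, if_pos (by omega), if_pos hi]
        refine ⟨ht.1.of_le hvt, ?_, ?_⟩
        · rw [← padZero_val v j, hp j le_rfl, padZero_val]; exact ht.2.1
        · rw [hp j le_rfl, ← ht.2.2]
          congr 2
          exact Finset.sum_congr rfl fun i hi => by rw [hp i (Finset.mem_range.1 hi).le]
      · intro i hi
        rw [hv, truncVec_apply, if_neg (by have := Fin.lt_def.1 hi; omega)]

lemma isStandard_iff_forall_crit {m : ℕ → ℕ} {k n : ℕ} (hk : 1 ≤ k) {s : Fin n →₀ ℕ} :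
    IsStandard m k s ↔ IsMFree m s ∧ ∀ t ∈ crit m k n, ¬ t ≤ s := by
  refine and_congr_right fun hs => ?_
  have h := forall_not_le_critBar_iff hk hs n
  constructor
  · intro hstd t ht hts
    obtain ⟨j, hj⟩ := Set.mem_iUnion.1 ht
    exact h.2 (fun j hj _ => hstd j hj) j j.2 t hj.1 hts
  · intro hc j hj
    refine h.1 (fun l _ t ht hts => ?_) j hj hj
    obtain ⟨l', u, hu, hut⟩ := exists_mem_critAt_le ht
    exact hc u (Set.mem_iUnion.2 ⟨l', hu⟩) (hut.trans hts)

/-- Two monomials critical at the same index have the same value of s_j + 2(s_0 + ⋯ + s_{j-1}), so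
divisibility forces equal exponents. Different indices are excluded by minimality or by the positive
last exponent. -/
lemma crit_antichain {m : ℕ → ℕ} {k n : ℕ} {s t : Fin n →₀ ℕ} (hs : s ∈ crit m k n)
    (ht : t ∈ crit m k n) (hts : t ≤ s) : t = s := by
  obtain ⟨j, hs⟩ := Set.mem_iUnion.1 hs
  obtain ⟨l, ht⟩ := Set.mem_iUnion.1 ht
  rcases lt_trichotomy l j with h | rfl | h
  · exact absurd hts (hs.2.2 l h t ht.1)
  · have h1 := (mem_critBar_iff.1 hs.1).2.2
    have h2 := (mem_critBar_iff.1 ht.1).2.2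
    have h3 := padZero_mono hts l
    have hle : ∀ i ∈ Finset.range l, (padZero t i : ℤ) ≤ padZero s i :=
      fun i _ => by exact_mod_cast padZero_mono hts i
    have h4 := Finset.sum_le_sum hle
    have h5 := (Finset.sum_eq_sum_iff_of_le hle).1 (by omega)
    ext i
    rcases lt_trichotomy i l with hi | rfl | hi
    · have := h5 i (Finset.mem_range.2 hi)
      simpa using this
    · have := padZero_val s i
      have := padZero_val t i
      omega
    · rw [hs.2.1 i hi, ht.2.1 i hi]
  · have := hts l
    have h0 := ht.1.2.1
    rw [hs.2.1 l h] at this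
    omega

end Standard

/-! ### Counting standard monomials by recursion on the last exponent. -/

section Counting

/-- The finset of `m`-free monomials in `n` variables. -/
noncomputable def freeMonomials (m : ℕ → ℕ) (n : ℕ) : Finset (Fin n →₀ ℕ) :=
  (Fintype.piFinset fun i : Fin n => Finset.range (m i)).map
    Finsupp.equivFunOnFinite.symm.toEmbedding

@[simp] lemma mem_freeMonomials {m : ℕ → ℕ} {n : ℕ} {s : Fin n →₀ ℕ} :
    s ∈ freeMonomials m n ↔ IsMFree m s := by
  simp only [freeMonomials, Finset.mem_map_equiv, Fintype.mem_piFinset, Finset.mem_range, IsMFree]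
  rfl

/-- The number of `m`-free monomials of degree `e` in `n` variables. -/
noncomputable def freeCount (m : ℕ → ℕ) (n : ℕ) (e : ℤ) : ℕ :=
  (Finset.card {s ∈ freeMonomials m n | (s.degree : ℤ) = e})

open Classical in
/-- The number of standard monomials of degree `e` in `n` variables. -/
noncomputable def stdCount (m : ℕ → ℕ) (k n : ℕ) (e : ℤ) : ℕ :=
  (Finset.card {s ∈ freeMonomials m n | IsStandard m k s ∧ (s.degree : ℤ) = e})

/-- Appending an exponent to an exponent vector. -/
noncomputable def snocVec {n : ℕ} (s : Fin n →₀ ℕ) (b : ℕ) : Fin (n + 1) →₀ ℕ :=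
  truncVec (n + 1) (Function.update (padZero s) n b)

lemma padZero_snocVec {n : ℕ} (s : Fin n →₀ ℕ) (b i : ℕ) :
    padZero (snocVec s b) i = if i = n then b else padZero s i := by
  rw [snocVec, padZero_truncVec]
  by_cases h : i = n
  · simp [h]
  · by_cases h' : i < n + 1
    · simp [h, h']
    · rw [if_neg h', if_neg h, padZero_of_le s (by omega)]

lemma sum_range_padZero_snocVec {n : ℕ} (s : Fin n →₀ ℕ) (b : ℕ) {j : ℕ} (hj : j ≤ n) :
    ∑ i ∈ Finset.range j, (padZero (snocVec s b) i : ℤ)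
      = ∑ i ∈ Finset.range j, (padZero s i : ℤ) :=
  Finset.sum_congr rfl fun i hi => by
    rw [padZero_snocVec, if_neg (by have := Finset.mem_range.1 hi; omega)]

lemma degree_snocVec {n : ℕ} (s : Fin n →₀ ℕ) (b : ℕ) :
    ((snocVec s b).degree : ℤ) = s.degree + b := by
  rw [degree_eq_sum_padZero _ le_rfl, degree_eq_sum_padZero s le_rfl, Finset.sum_range_succ]
  push_cast
  rw [sum_range_padZero_snocVec s b le_rfl, padZero_snocVec, if_pos rfl]

lemma isMFree_snocVec {m : ℕ → ℕ} {n : ℕ} {s : Fin n →₀ ℕ} {b : ℕ} :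
    IsMFree m (snocVec s b) ↔ IsMFree m s ∧ b < m n := by
  rw [isMFree_iff_padZero, isMFree_iff_padZero]
  constructor
  · intro h
    refine ⟨fun i hi => ?_, ?_⟩
    · have := h i (by omega)
      rwa [padZero_snocVec, if_neg hi.ne] at this
    · simpa [padZero_snocVec] using h n (by omega)
  · rintro ⟨h, hb⟩ i hi
    rw [padZero_snocVec]
    split_ifs with hin
    · rwa [hin]
    · exact h i (by omega)

lemma isStandard_snocVec {m : ℕ → ℕ} {k n : ℕ} {s : Fin n →₀ ℕ} {b : ℕ} :
    IsStandard m k (snocVec s b) ↔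
      b < m n ∧ IsStandard m k s ∧ (b : ℤ) + 2 * s.degree < k + topDegree m n := by
  have key : ∀ j, j < n → (((padZero (snocVec s b) j : ℕ) : ℤ)
      + 2 * ∑ i ∈ Finset.range j, (padZero (snocVec s b) i : ℤ)
      = (padZero s j : ℤ) + 2 * ∑ i ∈ Finset.range j, (padZero s i : ℤ)) := fun j hj => by
    rw [sum_range_padZero_snocVec s b hj.le, padZero_snocVec, if_neg hj.ne]
  have last : ((padZero (snocVec s b) n : ℕ) : ℤ)
      + 2 * ∑ i ∈ Finset.range n, (padZero (snocVec s b) i : ℤ) = b + 2 * s.degree := by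
    rw [sum_range_padZero_snocVec s b le_rfl, padZero_snocVec, if_pos rfl,
      degree_eq_sum_padZero s le_rfl]
    push_cast; rfl
  rw [IsStandard, IsStandard, isMFree_snocVec]
  constructor
  · rintro ⟨⟨h1, h2⟩, h3⟩
    exact ⟨h2, ⟨h1, fun j hj => key j hj ▸ h3 j (by omega)⟩, last ▸ h3 n (by omega)⟩
  · rintro ⟨h2, ⟨h1, h3⟩, h4⟩
    refine ⟨⟨h1, h2⟩, fun j hj => ?_⟩
    rcases Nat.lt_succ_iff_lt_or_eq.1 hj with hj | rfl
    · rw [key j hj]; exact h3 j hj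
    · rw [last]; exact h4

lemma card_filter_freeMonomials_succ (m : ℕ → ℕ) (n : ℕ) (Q : (Fin (n + 1) →₀ ℕ) → Prop)
    [DecidablePred Q] :
    (Finset.card {s ∈ freeMonomials m (n + 1) | Q s}) =
      ∑ b ∈ Finset.range (m n), (Finset.card {s ∈ freeMonomials m n | Q (snocVec s b)}) := by
  have snoc_trunc : ∀ s : Fin (n + 1) →₀ ℕ, snocVec (truncVec n (padZero s)) (padZero s n) = s := by
    intro s
    refine padZero_injective (funext fun i => ?_)
    rw [padZero_snocVec, padZero_truncVec]
    split_ifs with h1 h2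
    · rw [h1]
    · rfl
    · rw [padZero_of_le s (by omega)]
  rw [← Finset.card_sigma]
  refine Finset.card_bij' (fun s _ => ⟨padZero s n, truncVec n (padZero s)⟩)
    (fun p _ => snocVec p.2 p.1) ?_ ?_ ?_ ?_
  · intro s hs
    have hs' := Finset.mem_filter.1 hs
    have h : IsMFree m (snocVec (truncVec n (padZero s)) (padZero s n)) := by
      rw [snoc_trunc]; exact mem_freeMonomials.1 hs'.1
    rw [isMFree_snocVec] at h
    simp only [Finset.mem_sigma, Finset.mem_range, Finset.mem_filter, mem_freeMonomials]
    exact ⟨h.2, h.1, by rw [snoc_trunc]; exact hs'.2⟩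
  · intro p hp
    simp only [Finset.mem_sigma, Finset.mem_range, Finset.mem_filter, mem_freeMonomials] at hp ⊢
    exact ⟨isMFree_snocVec.2 ⟨hp.2.1, hp.1⟩, hp.2.2⟩
  · intro s _
    exact snoc_trunc s
  · rintro ⟨b, s⟩ _
    have h1 : padZero (snocVec s b) n = b := by simp [padZero_snocVec]
    have h2 : truncVec n (padZero (snocVec s b)) = s := by
      ext i
      rw [truncVec_apply, padZero_snocVec, if_neg i.2.ne, padZero_val]
    simp only [h1, h2]

lemma freeCount_succ (m : ℕ → ℕ) (n : ℕ) (e : ℤ) :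
    freeCount m (n + 1) e = ∑ b ∈ Finset.range (m n), freeCount m n (e - b) := by
  rw [freeCount, card_filter_freeMonomials_succ]
  refine Finset.sum_congr rfl fun b _ => ?_
  rw [freeCount]
  congr 1
  refine Finset.filter_congr fun s _ => ?_
  rw [degree_snocVec]
  constructor <;> intro h <;> linarith

lemma stdCount_succ (m : ℕ → ℕ) (k n : ℕ) (e : ℤ) :
    stdCount m k (n + 1) e = ∑ b ∈ Finset.range (m n),
      if 2 * e - b < k + topDegree m n then stdCount m k n (e - b) else 0 := by
  classical
  rw [stdCount, card_filter_freeMonomials_succ]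
  refine Finset.sum_congr rfl fun b hb => ?_
  have hb := Finset.mem_range.1 hb
  split_ifs with h
  · rw [stdCount]
    congr 1
    refine Finset.filter_congr fun s _ => ?_
    rw [degree_snocVec, isStandard_snocVec]
    constructor
    · rintro ⟨⟨-, h1, -⟩, h2⟩
      exact ⟨h1, by linarith⟩
    · rintro ⟨h1, h2⟩
      exact ⟨⟨hb, h1, by linarith⟩, by linarith⟩
  · rw [Finset.card_eq_zero, Finset.filter_eq_empty_iff]
    rintro s - ⟨hs, hd⟩
    rw [degree_snocVec] at hd
    have := (isStandard_snocVec.1 hs).2.2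
    exact h (by linarith)

lemma freeCount_zero (m : ℕ → ℕ) (e : ℤ) : freeCount m 0 e = if e = 0 then 1 else 0 := by
  classical
  have h : freeMonomials m 0 = {0} := by
    ext s; simp [Subsingleton.elim s 0, IsMFree]
  rw [freeCount, h, Finset.filter_singleton]
  simp only [map_zero, Nat.cast_zero, eq_comm (a := (0 : ℤ))]
  split_ifs <;> rfl

lemma stdCount_zero (m : ℕ → ℕ) (k : ℕ) (e : ℤ) : stdCount m k 0 e = if e = 0 then 1 else 0 := by
  classical
  rw [← freeCount_zero m e, stdCount, freeCount]
  congr 1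
  refine Finset.filter_congr fun s hs => ?_
  simp [IsStandard, mem_freeMonomials.1 hs]

/-- This is the symmetry s_i ↦ m_i - 1 - s_i, applied to one variable at a time. -/
lemma freeCount_symm (m : ℕ → ℕ) (n : ℕ) (e : ℤ) :
    freeCount m n (topDegree m n - e) = freeCount m n e := by
  induction n generalizing e with
  | zero => simp [freeCount_zero, topDegree]
  | succ n ih =>
    rw [freeCount_succ, freeCount_succ, ← Finset.sum_range_reflect]
    refine Finset.sum_congr rfl fun b hb => ?_
    have hb := Finset.mem_range.1 hb
    rw [← ih, topDegree_succ]
    congr 1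
    push_cast [show 1 ≤ m n by omega, show b ≤ m n - 1 by omega]
    ring

/-- The strong Lefschetz Hilbert function counts the standard monomials. -/
lemma stdCount_eq {m : ℕ → ℕ} (hm : ∀ i, 2 ≤ m i) {k : ℕ} (hk : 1 ≤ k) (n : ℕ) (e : ℤ) :
    (stdCount m k n e : ℤ) = if 2 * e ≤ topDegree m n + k
      then (freeCount m n e : ℤ) - freeCount m n (e - k) else 0 := by
  induction n generalizing e with
  | zero =>
    simp only [stdCount_zero, freeCount_zero, topDegree, Finset.range_zero, Finset.sum_empty]
    split_ifs <;> omega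
  | succ n ih =>
    set f : ℤ → ℤ := fun e => (freeCount m n e : ℤ) - freeCount m n (e - k) with hf
    -- Symmetry of `freeCount` makes `f` odd about half of `topDegree m n + k`.
    have hanti : ∀ a b, a + b = topDegree m n + k → f a = - f b := by
      intro a b hab
      have h1 := freeCount_symm m n a
      have h2 := freeCount_symm m n (a - k)
      rw [show topDegree m n - a = b - k by linarith] at h1
      rw [show topDegree m n - (a - k) = b by linarith] at h2
      simp only [hf, h1, h2]; ring
    have hfull : (freeCount m (n + 1) e : ℤ) - freeCount m (n + 1) (e - k)
        = ∑ b ∈ Finset.range (m n), f (e - b) := by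
      rw [freeCount_succ, freeCount_succ]
      push_cast
      rw [← Finset.sum_sub_distrib]
      exact Finset.sum_congr rfl fun b _ => by rw [hf]; congr 3; ring
    have hstd : (stdCount m k (n + 1) e : ℤ) = ∑ b ∈ Finset.range (m n),
        if 2 * e - b < k + topDegree m n then f (e - b) else 0 := by
      rw [stdCount_succ]
      push_cast
      refine Finset.sum_congr rfl fun b _ => ?_
      split_ifs with h
      · rw [ih, if_pos (by linarith)]
      · rfl
    rw [hstd, hfull, topDegree_succ]
    obtain hc | ⟨c, hc⟩ : 2 * e < k + topDegree m n ∨ ∃ c : ℕ, 2 * e = k + topDegree m n + c := by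
      rcases lt_or_ge (2 * e) (k + topDegree m n) with h | h
      · exact .inl h
      · exact .inr ⟨(2 * e - (k + topDegree m n)).toNat, by omega⟩
    · have := hm n
      rw [if_pos (by omega)]
      exact Finset.sum_congr rfl fun b _ => if_pos (by omega)
    · split_ifs with h
      · rw [← Finset.sum_filter, ← Finset.sum_filter_add_sum_filter_not (Finset.range (m n))
          (fun b : ℕ => 2 * e - b < k + topDegree m n)]
        rw [left_eq_add]
        -- The recursion for standard monomials drops exactly the exponents b ≤ c. The reflection b
        -- ↦ c - b pairs arguments of `f` with sum `topDegree m n + k`, so the dropped terms add up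
        -- to zero.
        have hset : Finset.filter (fun b : ℕ => ¬ 2 * e - b < k + topDegree m n)
            (Finset.range (m n)) = Finset.range (c + 1) := by
          ext b
          simp only [Finset.mem_filter, Finset.mem_range]
          omega
        rw [hset]
        have hS : ∑ b ∈ Finset.range (c + 1), f (e - b)
            = - ∑ b ∈ Finset.range (c + 1), f (e - b) := by
          conv_lhs => rw [← Finset.sum_range_reflect]
          rw [← Finset.sum_neg_distrib]
          refine Finset.sum_congr rfl fun b hb => hanti _ _ ?_
          have hb := Finset.mem_range.1 hb
          push_cast [show b ≤ c by omega, show c + 1 - 1 - b = c - b by omega]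
          linarith
        linarith
      · refine Finset.sum_eq_zero fun b hb => if_neg ?_
        have hb := Finset.mem_range.1 hb
        omega

/-- A cardinality is nonnegative, so `stdCount_eq` in degree e and in the reflected degree fixes the
sign of the difference on both sides of the centre. -/
lemma stdCount_eq_max {m : ℕ → ℕ} (hm : ∀ i, 2 ≤ m i) {k : ℕ} (hk : 1 ≤ k) (n : ℕ) (e : ℤ) :
    (stdCount m k n e : ℤ) = max 0 ((freeCount m n e : ℤ) - freeCount m n (e - k)) := by
  have h1 := stdCount_eq hm hk n e
  have h2 := stdCount_eq hm hk n (topDegree m n + k - e)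
  rw [show topDegree m n + k - e = topDegree m n - (e - k) by ring, freeCount_symm,
    show topDegree m n - (e - k) - k = topDegree m n - e by ring, freeCount_symm] at h2
  split_ifs at h1 h2 <;> omega

/-- The inequality is strict because at the centre the two free counts agree by symmetry. -/
lemma two_mul_lt_of_stdCount_pos {m : ℕ → ℕ} (hm : ∀ i, 2 ≤ m i) {k : ℕ} (hk : 1 ≤ k) {n : ℕ}
    {e : ℤ} (h : 0 < stdCount m k n e) : 2 * e < topDegree m n + k := by
  have h1 := stdCount_eq hm hk n e
  have h2 := freeCount_symm m n e
  by_contra! hle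
  split_ifs at h1 with h'
  · rw [show topDegree m n - e = e - k by linarith] at h2
    omega
  · omega

end Counting

/-! ### Degrees and numbers of critical monomials. -/

section CritCounting

lemma sum_range_padZero_truncVec {n : ℕ} (s : Fin n →₀ ℕ) {i j : ℕ} (hij : i ≤ j) :
    ∑ l ∈ Finset.range i, (padZero (truncVec j (padZero s)) l : ℤ)
      = ∑ l ∈ Finset.range i, (padZero s l : ℤ) :=
  Finset.sum_congr rfl fun l hl => by
    rw [padZero_truncVec, if_pos ((Finset.mem_range.1 hl).trans_le hij)]

lemma degree_truncVec_padZero {n : ℕ} (s : Fin n →₀ ℕ) (j : ℕ) :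
    ((truncVec j (padZero s)).degree : ℤ) = ∑ l ∈ Finset.range j, (padZero s l : ℤ) := by
  rw [degree_eq_sum_padZero _ le_rfl]
  push_cast
  exact sum_range_padZero_truncVec s le_rfl

/-- Absence of earlier critical divisors is a condition on the prefix alone, namely standardness;
the prefix degree then forces the last exponent. -/
lemma mem_critAt_iff {m : ℕ → ℕ} (hm : ∀ i, 2 ≤ m i) {k n : ℕ} (hk : 1 ≤ k) {j : Fin n}
    {s : Fin n →₀ ℕ} :
    s ∈ critAt m k n j ↔ (∀ i, j < i → s i = 0) ∧ IsStandard m k (truncVec j (padZero s)) ∧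
      0 < s j ∧ s j < m j ∧
      (s j : ℤ) + 2 * (truncVec j (padZero s)).degree = k + topDegree m j := by
  rw [degree_truncVec_padZero]
  have hstd : IsMFree m s → ((∀ l, l < j → ∀ t ∈ critBar m k n l, ¬ t ≤ s) ↔
      IsStandard m k (truncVec j (padZero s))) := by
    intro hs
    refine (forall_not_le_critBar_iff hk hs j).trans ⟨fun h => ⟨?_, fun i hi => ?_⟩, ?_⟩
    · rw [isMFree_iff_padZero] at hs ⊢
      intro i hi
      rw [padZero_truncVec, if_pos hi]
      exact hs i (hi.trans j.2)
    · rw [sum_range_padZero_truncVec s hi.le, padZero_truncVec, if_pos hi]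
      exact h i (hi.trans j.2) hi
    · intro h i _ hi
      have := h.2 i hi
      rwa [sum_range_padZero_truncVec s hi.le, padZero_truncVec, if_pos hi] at this
  constructor
  · rintro ⟨h1, h2, h3⟩
    have h1' := mem_critBar_iff.1 h1
    refine ⟨h2, (hstd h1'.1).1 h3, h1'.2.1, h1'.1 j, ?_⟩
    rw [← h1'.2.2, padZero_val]
  · rintro ⟨h1, h2, h3, h4, h5⟩
    have hs : IsMFree m s := by
      intro i
      rcases lt_trichotomy i j with hi | rfl | hi
      · have := h2.1 ⟨i, hi⟩
        simpa using this
      · exact h4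
      · rw [h1 i hi]; have := hm i; omega
    exact ⟨mem_critBar_iff.2 ⟨hs, h3, by rw [padZero_val]; exact h5⟩, h1, (hstd hs).2 h2⟩

lemma degree_of_forall_gt {n : ℕ} {j : Fin n} {s : Fin n →₀ ℕ} (h : ∀ i, j < i → s i = 0) :
    (s.degree : ℤ) = (truncVec j (padZero s)).degree + s j := by
  rw [degree_truncVec_padZero, degree_eq_sum_padZero s le_rfl,
    ← Finset.sum_subset (Finset.range_mono (show (j : ℕ) + 1 ≤ n from j.2)),
    Finset.sum_range_succ, padZero_val]
  · push_cast; rfl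
  · intro i hi hij
    simp only [Finset.mem_range] at hi hij
    rw [padZero, dif_pos hi, h ⟨i, hi⟩ (Fin.lt_def.2 (by simp; omega))]

/-- Twice the degree is k + T_j plus the last exponent, which lies strictly between 0 and m_j. This
window is what ties a degree to a single index. -/
lemma degree_mem_of_mem_critAt {m : ℕ → ℕ} (hm : ∀ i, 2 ≤ m i) {k n : ℕ} (hk : 1 ≤ k) {j : Fin n}
    {s : Fin n →₀ ℕ} (hs : s ∈ critAt m k n j) :
    topDegree m j + k < 2 * s.degree ∧ 2 * (s.degree : ℤ) ≤ topDegree m (j + 1) + k := by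
  obtain ⟨h1, -, h3, h4, h5⟩ := (mem_critAt_iff hm hk).1 hs
  rw [degree_of_forall_gt h1, topDegree_succ]
  omega

lemma ncard_critAt_degree {m : ℕ → ℕ} (hm : ∀ i, 2 ≤ m i) {k n : ℕ} (hk : 1 ≤ k) {j : Fin n}
    {d : ℕ} (hd : topDegree m j + k < 2 * d) (hd' : 2 * (d : ℤ) ≤ topDegree m (j + 1) + k) :
    {s | s ∈ critAt m k n j ∧ s.degree = d}.ncard = stdCount m k j (topDegree m j + k - d) := by
  classical
  rw [stdCount, ← Set.ncard_coe_finset]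
  refine Set.ncard_congr (fun s _ => truncVec j (padZero s)) ?_ ?_ ?_
  · rintro s ⟨hs, rfl⟩
    obtain ⟨h1, h2, h3, h4, h5⟩ := (mem_critAt_iff hm hk).1 hs
    have := degree_of_forall_gt h1
    simp only [Finset.coe_filter, mem_freeMonomials, Set.mem_ofPred_eq]
    exact ⟨h2.1, h2, by omega⟩
  · rintro s t ⟨hs, rfl⟩ ⟨ht, htd⟩ hst
    obtain ⟨h1, -, -, -, h5⟩ := (mem_critAt_iff hm hk).1 hs
    obtain ⟨h1', -, -, -, h5'⟩ := (mem_critAt_iff hm hk).1 ht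
    rw [hst] at h5
    ext i
    rcases lt_trichotomy i j with hi | rfl | hi
    · simpa using DFunLike.congr_fun hst ⟨i, hi⟩
    · omega
    · rw [h1 i hi, h1' i hi]
  · intro t ht
    simp only [Finset.coe_filter, mem_freeMonomials, Set.mem_ofPred_eq] at ht
    obtain ⟨-, ht, htd⟩ := ht
    -- The last exponent is determined by the degree; the window for `d` says precisely that 0 < b <
    -- m_j.
    obtain ⟨b, hb⟩ : ∃ b : ℕ, (b : ℤ) = 2 * d - topDegree m j - k :=
      ⟨(2 * d - topDegree m j - k : ℤ).toNat, Int.toNat_of_nonneg (by omega)⟩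
    set s := truncVec n (Function.update (padZero t) j b) with hs
    have h1 : ∀ i, j < i → s i = 0 := fun i hi => by
      have hi := Fin.lt_def.1 hi
      rw [hs, truncVec_apply, Function.update_of_ne (by omega), padZero_of_le t hi.le]
    have h2 : truncVec j (padZero s) = t := by
      ext i
      rw [truncVec_apply, hs, padZero_truncVec, if_pos (i.2.trans j.2),
        Function.update_of_ne i.2.ne, padZero_val]
    have h3 : s j = b := by simp [hs]
    have h4 := degree_of_forall_gt h1
    rw [topDegree_succ] at hd'
    refine ⟨s, ⟨(mem_critAt_iff hm hk).2 ⟨h1, ?_, ?_, ?_, ?_⟩, ?_⟩, h2⟩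
    · rwa [h2]
    · omega
    · omega
    · rw [h2]; omega
    · rw [h2] at h4; omega

lemma critAt_index_unique {m : ℕ → ℕ} (hm : ∀ i, 2 ≤ m i) {k d i j : ℕ}
    (hi : topDegree m i + k < 2 * d ∧ 2 * (d : ℤ) ≤ topDegree m (i + 1) + k)
    (hj : topDegree m j + k < 2 * d ∧ 2 * (d : ℤ) ≤ topDegree m (j + 1) + k) : i = j := by
  have hmono := topDegree_strictMono hm
  have h1 := hmono.lt_iff_lt.1 (show topDegree m i < topDegree m (j + 1) by linarith [hi.1, hj.2])
  have h2 := hmono.lt_iff_lt.1 (show topDegree m j < topDegree m (i + 1) by linarith [hj.1, hi.2])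
  omega

/-- The windows cover everything above k, since T_q ≥ q is unbounded, and 2d > k because d ≥ k ≥ 1.
-/
lemma exists_critAt_index {m : ℕ → ℕ} (hm : ∀ i, 2 ≤ m i) {k d : ℕ} (hk : 1 ≤ k) (hd : k ≤ d) :
    ∃ q, topDegree m q + k < 2 * d ∧ 2 * (d : ℤ) ≤ topDegree m (q + 1) + k := by
  have hge : ∀ n : ℕ, (n : ℤ) ≤ topDegree m n := by
    intro n
    induction n with
    | zero => simp [topDegree]
    | succ n ih => have := hm n; rw [topDegree_succ]; push_cast; omega
  have hex : ∃ n : ℕ, 2 * (d : ℤ) ≤ topDegree m n + k := ⟨2 * d, by have := hge (2 * d); omega⟩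
  classical
  obtain ⟨q, hq⟩ : ∃ q, Nat.find hex = q + 1 := by
    refine Nat.exists_eq_succ_of_ne_zero fun h0 => ?_
    have := Nat.find_spec hex
    rw [h0] at this
    simp [topDegree] at this
    omega
  refine ⟨q, ?_, hq ▸ Nat.find_spec hex⟩
  have := Nat.find_min hex (show q < _ by omega)
  omega

lemma critCount_eq {m : ℕ → ℕ} (hm : ∀ i, 2 ≤ m i) {k d q : ℕ} (hk : 1 ≤ k)
    (hq : topDegree m q + k < 2 * d ∧ 2 * (d : ℤ) ≤ topDegree m (q + 1) + k) {n : ℕ}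
    (hn : q + 1 ≤ n) : critCount m k n d = stdCount m k q (topDegree m q + k - d) := by
  rw [← ncard_critAt_degree hm hk (j := ⟨q, hn⟩) hq.1 hq.2, critCount]
  congr 1
  ext s
  constructor
  · rintro ⟨hs, rfl⟩
    obtain ⟨j, hj⟩ := Set.mem_iUnion.1 hs
    have := critAt_index_unique hm (degree_mem_of_mem_critAt hm hk hj) hq
    rw [show (⟨q, hn⟩ : Fin n) = j from Fin.ext this.symm]
    exact ⟨hj, rfl⟩
  · rintro ⟨hs, hd⟩
    exact ⟨Set.mem_iUnion.2 ⟨_, hs⟩, hd⟩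

lemma gSeq_eq {m : ℕ → ℕ} (hm : ∀ i, 2 ≤ m i) {k d q : ℕ} (hk : 1 ≤ k)
    (hq : topDegree m q + k < 2 * d ∧ 2 * (d : ℤ) ≤ topDegree m (q + 1) + k) :
    gSeq m k d = stdCount m k q (topDegree m q + k - d) := by
  refine Filter.Tendsto.limUnder_eq (tendsto_const_nhds.congr' ?_)
  filter_upwards [Filter.eventually_ge_atTop (q + 1)] with n hn
  exact (critCount_eq hm hk hq hn).symm

end CritCounting

/-! ### Forms in two variables with a prescribed initial term. -/

section BinaryForms

open Polynomial in
/-- A polynomial of the form `h (1 + X)^k` with `deg h < m - p` is zero if its coefficients in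
degrees `p, …, m - 1` vanish. -/
lemma eq_zero_of_coeff_mul_pow_eq_zero {K : Type*} [Field K] [CharZero K] {p k m : ℕ}
    (hpk : p < k) (hpm : p < m) {h : K[X]} (hdeg : h.degree < (m - p : ℕ))
    (hc : ∀ i, p ≤ i → i < m → (h * (X + 1) ^ k).coeff i = 0) : h = 0 := by
  set g := h * (X + 1) ^ k with hg
  by_contra hne
  have hX1 : (X + 1 : K[X]) = X + C 1 := by simp
  have hmonic : ((X + 1 : K[X]) ^ k).Monic := by rw [hX1]; exact (monic_X_add_C 1).pow k
  have hnd : ((X + 1 : K[X]) ^ k).natDegree = k := by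
    rw [hX1, natDegree_pow, natDegree_X_add_C, mul_one]
  have hgne : g ≠ 0 := mul_ne_zero hne hmonic.ne_zero
  have hgdeg : g.natDegree = h.natDegree + k := by
    rw [hg, natDegree_mul hne hmonic.ne_zero, hnd]
  have hhdeg : h.natDegree < m - p := (natDegree_lt_iff_degree_lt hne).2 hdeg
  -- The p-th derivative is divisible by X^(m-p), because the vanishing coefficients shift down by
  -- p, and by (X+1)^(k-p); the product of these coprime factors has too large a degree.
  have hzero : derivative^[p] g = 0 := by
    have h1 : (X + 1 : K[X]) ^ (k - p) ∣ derivative^[p] g :=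
      pow_sub_dvd_iterate_derivative_of_pow_dvd p (Dvd.intro_left h rfl)
    have h2 : (X : K[X]) ^ (m - p) ∣ derivative^[p] g := by
      rw [X_pow_dvd_iff]
      intro i hi
      rw [coeff_iterate_derivative, hc _ (by omega) (by omega), smul_zero]
    have hcop : IsCoprime ((X : K[X]) ^ (m - p)) ((X + 1) ^ (k - p)) :=
      IsCoprime.pow ⟨-1, 1, by ring⟩
    refine eq_zero_of_dvd_of_natDegree_lt (hcop.mul_dvd h2 h1) ?_
    have hm1 : ((X + 1 : K[X]) ^ (k - p)).Monic := by rw [hX1]; exact (monic_X_add_C 1).pow _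
    rw [(monic_X_pow (m - p)).natDegree_mul hm1, natDegree_X_pow, hX1, natDegree_pow,
      natDegree_X_add_C]
    have := natDegree_iterate_derivative g p
    omega
  -- Characteristic zero enters here: the leading coefficient survives since deg g ≥ k > p.
  have hlead : (derivative^[p] g).coeff (g.natDegree - p) ≠ 0 := by
    rw [coeff_iterate_derivative, show g.natDegree - p + p = g.natDegree by omega, nsmul_eq_mul]
    refine mul_ne_zero ?_ (leadingCoeff_ne_zero.2 hgne)
    exact_mod_cast (Nat.descFactorial_pos.2 (by omega)).ne'
  rw [hzero] at hlead
  exact hlead (coeff_zero _)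

open Polynomial in
-- This is a square linear system: m - p unknown coefficients of `h` against the coefficients p, …,
-- m-1 of the product. `eq_zero_of_coeff_mul_pow_eq_zero` gives injectivity, hence solvability.
lemma exists_coeff_mul_pow {K : Type*} [Field K] [CharZero K] {p k m : ℕ}
    (hpk : p < k) (hpm : p < m) : ∃ h : K[X], h.degree < (m - p : ℕ) ∧
      (h * (X + 1) ^ k).coeff p = 1 ∧
      ∀ i, p < i → i < m → (h * (X + 1) ^ k).coeff i = 0 := by
  let Φ : degreeLT K (m - p) →ₗ[K] (Fin (m - p) → K) :=
    LinearMap.pi fun i => (lcoeff K (p + i)) ∘ₗ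
      (LinearMap.mulRight K ((X + 1 : K[X]) ^ k)) ∘ₗ (degreeLT K (m - p)).subtype
  have hΦ : ∀ h i, Φ h i = ((h : K[X]) * (X + 1) ^ k).coeff (p + i) := fun h i => rfl
  have hinj : Function.Injective (Φ ∘ₗ (degreeLTEquiv K (m - p)).symm.toLinearMap) := by
    rw [LinearMap.coe_comp]
    refine Function.Injective.comp ?_ (LinearEquiv.injective _)
    rw [injective_iff_map_eq_zero]
    rintro ⟨h, hh⟩ h0
    refine Subtype.ext (eq_zero_of_coeff_mul_pow_eq_zero hpk hpm (mem_degreeLT.1 hh) ?_)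
    intro i hpi him
    have := congrFun h0 ⟨i - p, by omega⟩
    rw [hΦ] at this
    simpa [show p + (i - p) = i by omega] using this
  obtain ⟨w, hw⟩ := LinearMap.injective_iff_surjective.1 hinj (Pi.single ⟨0, by omega⟩ 1)
  set h := (degreeLTEquiv K (m - p)).symm w
  have hw : Φ h = Pi.single ⟨0, by omega⟩ 1 := hw
  refine ⟨h, mem_degreeLT.1 h.2, ?_, fun i hpi him => ?_⟩
  · have := congrFun hw ⟨0, by omega⟩
    rw [hΦ] at this
    simpa using this
  · have := congrFun hw ⟨i - p, by omega⟩
    rw [hΦ, Pi.single_eq_of_ne (by simp; omega)] at this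
    simpa [show p + (i - p) = i by omega] using this

lemma aeval_homogenize {K B : Type*} [Field K] [CommRing B] [Algebra K B] (f : Polynomial K)
    (n : ℕ) (x y : B) : MvPolynomial.aeval ![x, y] (f.homogenize n) =
      ∑ i ∈ Finset.range (n + 1), f.coeff i • (x ^ i * y ^ (n - i)) := by
  rw [Polynomial.homogenize, map_sum, Finset.Nat.sum_antidiagonal_eq_sum_range_succ_mk]
  refine Finset.sum_congr rfl fun i _ => ?_
  rw [MvPolynomial.aeval_monomial, Algebra.smul_def, Finsupp.prod_fintype _ _ (by simp)]
  simp [Fin.prod_univ_two]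

/-- Forms in two elements `x`, `y` of the ideal `(x^m, (x + y)^k)` without monomials divisible by
`x^{p + 1}`. -/
lemma exists_binaryForm_mem {K : Type*} [Field K] [CharZero K] {p k m : ℕ}
    (hpk : p < k) (hpm : p < m) : ∃ c : ℕ → K, c p = 1 ∧
      ∀ {B : Type*} [CommRing B] [Algebra K B] (x y : B),
        ∑ i ∈ Finset.range (p + 1), c i • (x ^ i * y ^ (k + m - 1 - p - i)) ∈
          Ideal.span {x ^ m, (x + y) ^ k} := by
  obtain ⟨h, hdeg, hp, hz⟩ := exists_coeff_mul_pow (K := K) hpk hpm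
  set g := h * (Polynomial.X + 1) ^ k with hg
  refine ⟨g.coeff, hp, fun {B} _ _ x y => ?_⟩
  have hhdeg : h.natDegree ≤ m - 1 - p := by
    by_cases h0 : h = 0
    · simp [h0]
    · have := (Polynomial.natDegree_lt_iff_degree_lt h0).2 hdeg
      omega
  have hX1 : (Polynomial.X + 1 : Polynomial K).natDegree = 1 := by
    rw [show (Polynomial.X + 1 : Polynomial K) = Polynomial.X + Polynomial.C 1 by simp,
      Polynomial.natDegree_X_add_C]
  have hpow : ∀ k : ℕ, MvPolynomial.aeval ![x, y]
      (((Polynomial.X + 1 : Polynomial K) ^ k).homogenize k) = (x + y) ^ k := by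
    intro k
    induction k with
    | zero => simp
    | succ k ih =>
      rw [pow_succ, Polynomial.homogenize_mul _ _ (n := 1) _ hX1.le, map_mul, ih, pow_succ]
      · congr 1
        rw [aeval_homogenize]
        simp [Finset.sum_range_succ, Polynomial.coeff_one, Polynomial.coeff_X, add_comm]
      · rw [Polynomial.natDegree_pow, hX1, mul_one]
  have hfull : ∑ i ∈ Finset.range (k + m - 1 - p + 1), g.coeff i • (x ^ i * y ^ (k + m - 1 - p - i))
      ∈ Ideal.span {x ^ m, (x + y) ^ k} := by
    rw [← aeval_homogenize, hg, show k + m - 1 - p = m - 1 - p + k by omega,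
      Polynomial.homogenize_mul _ _ hhdeg (by rw [Polynomial.natDegree_pow, hX1, mul_one]),
      map_mul, hpow]
    exact Ideal.mul_mem_left _ _ (Ideal.subset_span (by simp))
  have hle : p + 1 ≤ k + m - 1 - p + 1 := by omega
  rw [← Finset.sum_range_add_sum_Ico _ hle] at hfull
  -- Of the homogenized multiple of (x+y)^k, the terms with p < i < m vanish and those with i ≥ m
  -- are multiples of x^m.
  refine (Ideal.add_mem_iff_left _ (Ideal.sum_mem _ fun i hi => ?_)).1 hfull
  have hi := Finset.mem_Ico.1 hi
  by_cases him : i < m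
  · rw [hz i (by omega) him, zero_smul]; exact Ideal.zero_mem _
  · rw [show i = m + (i - m) by omega, pow_add, mul_assoc, Algebra.smul_def]
    exact Ideal.mul_mem_left _ _ (Ideal.mul_mem_right _ _ (Ideal.subset_span (by simp)))

end BinaryForms

/-! ### Weight bounds on supports, used in place of a monomial order. -/

section WeightBounds

variable {R M σ : Type*} [CommSemiring R] [AddCommMonoid M] [LinearOrder M] [Fintype σ]

/-- All monomials of `f` have `φ`-weight at most `W`. -/
def SuppWeightLE (φ : σ → M) (W : M) (f : MvPolynomial σ R) : Prop :=
  ∀ t ∈ f.support, ∑ i, t i • φ i ≤ W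

lemma SuppWeightLE.mul [IsOrderedAddMonoid M] {φ : σ → M} {V W : M} {f g : MvPolynomial σ R}
    (hf : SuppWeightLE φ V f) (hg : SuppWeightLE φ W g) : SuppWeightLE φ (V + W) (f * g) := by
  classical
  intro t ht
  obtain ⟨a, ha, b, hb, rfl⟩ := Finset.mem_add.1 (MvPolynomial.support_mul f g ht)
  simp only [Finsupp.add_apply, add_smul, Finset.sum_add_distrib]
  exact add_le_add (hf a ha) (hg b hb)

lemma SuppWeightLE.sum {ι : Type*} {φ : σ → M} {W : M} {s : Finset ι} {f : ι → MvPolynomial σ R}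
    (h : ∀ i ∈ s, SuppWeightLE φ W (f i)) : SuppWeightLE φ W (∑ i ∈ s, f i) := by
  classical
  intro t ht
  obtain ⟨i, hi, hti⟩ := Finset.mem_biUnion.1 (MvPolynomial.support_sum ht)
  exact h i hi t hti

lemma SuppWeightLE.smul {φ : σ → M} {W : M} {f : MvPolynomial σ R} (h : SuppWeightLE φ W f)
    (c : R) : SuppWeightLE φ W (c • f) := fun t ht => h t (MvPolynomial.support_smul ht)

lemma SuppWeightLE.one (φ : σ → M) : SuppWeightLE φ 0 (1 : MvPolynomial σ R) := by
  classical
  intro t ht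
  rw [MvPolynomial.mem_support_iff, MvPolynomial.coeff_one] at ht
  obtain rfl : 0 = t := by by_contra h; simp [h] at ht
  simp

lemma SuppWeightLE.pow [IsOrderedAddMonoid M] {φ : σ → M} {W : M} {f : MvPolynomial σ R}
    (h : SuppWeightLE φ W f) (n : ℕ) : SuppWeightLE φ (n • W) (f ^ n) := by
  induction n with
  | zero => simpa using SuppWeightLE.one φ
  | succ n ih => rw [pow_succ, succ_nsmul]; exact ih.mul h

lemma SuppWeightLE.mono {φ : σ → M} {V W : M} {f : MvPolynomial σ R} (h : SuppWeightLE φ V f)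
    (hVW : V ≤ W) : SuppWeightLE φ W f := fun t ht => (h t ht).trans hVW

lemma SuppWeightLE.X (φ : σ → M) (i : σ) :
    SuppWeightLE φ (φ i) (MvPolynomial.X i : MvPolynomial σ R) := by
  classical
  intro t ht
  rw [MvPolynomial.mem_support_iff, MvPolynomial.coeff_X] at ht
  obtain rfl : Finsupp.single i 1 = t := by by_contra h; simp [h] at ht
  rw [Finset.sum_eq_single i]
  · simp
  · intro j _ hj
    simp [Finsupp.single_eq_of_ne hj]
  · simp

lemma SuppWeightLE.rename_succ {n : ℕ} {φ : Fin (n + 1) → M} {W : M} {f : MvPolynomial (Fin n) R}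
    (h : SuppWeightLE (φ ∘ Fin.succ) W f) :
    SuppWeightLE φ W (MvPolynomial.rename Fin.succ f) := by
  classical
  intro t ht
  rw [MvPolynomial.support_rename_of_injective (Fin.succ_injective n)] at ht
  obtain ⟨u, hu, rfl⟩ := Finset.mem_image.1 ht
  rw [Fin.sum_univ_succ, Finsupp.mapDomain_of_notMem_range _ _ (by simp)]
  simpa [Finsupp.mapDomain_apply (Fin.succ_injective n)] using h u hu

end WeightBounds

/-! ### Elements of the ideal led by critical monomials. -/

section LeadingElements

variable {K : Type*} [Field K]

lemma coeff_cons_X_pow_mul_rename_succ {n : ℕ} (p i : ℕ) (s : Fin n →₀ ℕ)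
    (f : MvPolynomial (Fin n) K) :
    MvPolynomial.coeff (Finsupp.cons p s)
      (MvPolynomial.X 0 ^ i * MvPolynomial.rename Fin.succ f) =
      if p = i then MvPolynomial.coeff s f else 0 := by
  have h : (MvPolynomial.finSuccEquiv K n) (MvPolynomial.rename Fin.succ f) = Polynomial.C f := by
    induction f using MvPolynomial.induction_on with
    | C a =>
      rw [MvPolynomial.rename_C, ← MvPolynomial.finSuccEquiv_comp_C_eq_C]
      simp
    | add f g hf hg => rw [map_add, map_add, hf, hg, Polynomial.C_add]
    | mul_X f j hf =>
      rw [map_mul, map_mul, hf, MvPolynomial.rename_X, MvPolynomial.finSuccEquiv_X_succ,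
        Polynomial.C_mul]
  rw [← MvPolynomial.finSuccEquiv_coeff_coeff, map_mul, map_pow, MvPolynomial.finSuccEquiv_X_zero,
    h, Polynomial.X_pow_mul_C, Polynomial.coeff_C_mul_X_pow]
  split_ifs <;> simp

lemma sum_weight_cons {M : Type*} [AddCommMonoid M] {n : ℕ} (φ : Fin (n + 1) → M) (p : ℕ)
    (s : Fin n →₀ ℕ) : ∑ i, Finsupp.cons p s i • φ i = p • φ 0 + ∑ i, s i • φ i.succ := by
  rw [Fin.sum_univ_succ]; simp

/-- Gluing a form in `x_1` and `x_2 + ⋯ + x_n` with a polynomial in `x_2, …, x_n` of known initial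
monomial. -/
lemma coeff_and_weight_of_glue {M : Type*} [AddCommMonoid M] [LinearOrder M]
    [IsOrderedAddMonoid M] {n : ℕ} {φ : Fin (n + 1) → M} (hφ : Antitone φ) {p : ℕ}
    {s : Fin n →₀ ℕ} {g : MvPolynomial (Fin n) K} (hg : MvPolynomial.coeff s g = 1)
    (hgw : SuppWeightLE (φ ∘ Fin.succ) (∑ i, s i • φ i.succ) g) {c : ℕ → K} (hc : c p = 1) :
    MvPolynomial.coeff (Finsupp.cons p s) (∑ i ∈ Finset.range (p + 1), c i •
      (MvPolynomial.X 0 ^ i * MvPolynomial.rename Fin.succ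
        ((∑ j, MvPolynomial.X j) ^ (p - i) * g))) = 1 ∧
    SuppWeightLE φ (∑ i, Finsupp.cons p s i • φ i) (∑ i ∈ Finset.range (p + 1), c i •
      (MvPolynomial.X 0 ^ i * MvPolynomial.rename Fin.succ
        ((∑ j, MvPolynomial.X j) ^ (p - i) * g))) := by
  constructor
  · simp only [MvPolynomial.coeff_sum, MvPolynomial.coeff_smul, coeff_cons_X_pow_mul_rename_succ]
    rw [Finset.sum_eq_single p]
    · simp [hc, hg]
    · intro i _ hi
      simp [hi.symm]
    · simp
  · refine SuppWeightLE.sum fun i hi => SuppWeightLE.smul ?_ _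
    have hi := Finset.mem_range.1 hi
    -- Since x_1 has the largest weight, trading copies of x_1 for the linear form in the other
    -- variables cannot raise the weight.
    have hl : SuppWeightLE (φ ∘ Fin.succ) (φ 0) (∑ j : Fin n, MvPolynomial.X j :
        MvPolynomial (Fin n) K) :=
      SuppWeightLE.sum fun j _ => (SuppWeightLE.X (φ ∘ Fin.succ) j).mono (hφ (Fin.zero_le _))
    rw [sum_weight_cons, show p • φ 0 = i • φ 0 + (p - i) • φ 0 by
      rw [← add_smul, show i + (p - i) = p by omega], add_assoc]
    exact ((SuppWeightLE.X φ 0).pow i).mul ((hl.pow (p - i)).mul hgw).rename_succ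

lemma X_pow_mem_idealI (m : ℕ → ℕ) (k : ℕ) {n : ℕ} (i : Fin n) :
    (MvPolynomial.X i : MvPolynomial (Fin n) K) ^ m i ∈ idealI K m k n :=
  Ideal.mem_sup_left (Ideal.subset_span ⟨i, rfl⟩)

lemma sum_pow_mem_idealI (m : ℕ → ℕ) (k n : ℕ) :
    (∑ i : Fin n, (MvPolynomial.X i : MvPolynomial (Fin n) K)) ^ k ∈ idealI K m k n :=
  Ideal.mem_sup_right (Ideal.subset_span rfl)

lemma rename_succ_mem_idealI {m : ℕ → ℕ} {k n : ℕ} {f : MvPolynomial (Fin n) K}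
    (hf : f ∈ idealP K (fun i => m (i + 1)) n) :
    MvPolynomial.rename Fin.succ f ∈ idealI K m k (n + 1) := by
  have h := Ideal.mem_map_of_mem (MvPolynomial.rename (R := K) (Fin.succ (n := n))) hf
  rw [idealP, Ideal.map_span] at h
  refine Ideal.span_le.2 ?_ h
  rintro _ ⟨_, ⟨i, rfl⟩, rfl⟩
  simpa using X_pow_mem_idealI (K := K) m k i.succ

lemma padZero_cons_succ {n : ℕ} (p : ℕ) (s : Fin n →₀ ℕ) (i : ℕ) :
    padZero (Finsupp.cons p s) (i + 1) = padZero s i := by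
  by_cases h : i < n
  · rw [padZero, padZero, dif_pos h, dif_pos (by omega)]
    exact Finsupp.cons_succ ⟨i, h⟩ p s
  · rw [padZero, padZero, dif_neg h, dif_neg (by omega)]

lemma padZero_cons_zero {n : ℕ} (p : ℕ) (s : Fin n →₀ ℕ) :
    padZero (Finsupp.cons p s) 0 = p := by
  rw [padZero, dif_pos (by omega)]
  exact Finsupp.cons_zero p s

lemma isMFree_cons {m : ℕ → ℕ} {n p : ℕ} {s : Fin n →₀ ℕ} :
    IsMFree m (Finsupp.cons p s) ↔ p < m 0 ∧ IsMFree (fun i => m (i + 1)) s := by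
  rw [IsMFree, Fin.forall_fin_succ]
  simp [IsMFree]

/-- Removing x_1^p lowers the left side of the equality by 2p and T by m_0 - 1, so k is replaced by
k + m_0 - 1 - 2p. The two bounds on p keep this number positive. -/
lemma cons_mem_critBar_succ {m : ℕ → ℕ} {k n p : ℕ} {s : Fin n →₀ ℕ} (hpk : p < k) (hpm : p < m 0)
    (j : Fin n) : Finsupp.cons p s ∈ critBar m k (n + 1) j.succ ↔
      s ∈ critBar (fun i => m (i + 1)) (k + m 0 - 1 - 2 * p) n j := by
  rw [mem_critBar_iff, mem_critBar_iff, isMFree_cons, Finsupp.cons_succ, Fin.val_succ,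
    padZero_cons_succ, Finset.sum_range_succ', padZero_cons_zero, topDegree,
    Finset.sum_range_succ', topDegree]
  simp only [padZero_cons_succ]
  have h : ((k + m 0 - 1 - 2 * p : ℕ) : ℤ) = k + m 0 - 1 - 2 * p := by omega
  rw [h]
  constructor
  · rintro ⟨⟨-, h1⟩, h2, h3⟩
    exact ⟨h1, h2, by linarith⟩
  · rintro ⟨h1, h2, h3⟩
    exact ⟨⟨hpm, h1⟩, h2, by linarith⟩

lemma tail_mem_critAt {m : ℕ → ℕ} {k n p : ℕ} {s : Fin n →₀ ℕ} (hpk : p < k) (hpm : p < m 0)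
    {j : Fin n} (hs : Finsupp.cons p s ∈ critAt m k (n + 1) j.succ) :
    s ∈ critAt (fun i => m (i + 1)) (k + m 0 - 1 - 2 * p) n j := by
  obtain ⟨h1, h2, h3⟩ := hs
  refine ⟨(cons_mem_critBar_succ hpk hpm j).1 h1, fun i hi => ?_, fun l hl t ht hts => ?_⟩
  · simpa using h2 i.succ (Fin.succ_lt_succ_iff.2 hi)
  · refine h3 l.succ (Fin.succ_lt_succ_iff.2 hl) _ ((cons_mem_critBar_succ hpk hpm l).2 ht) ?_
    intro i
    refine Fin.cases ?_ (fun i => ?_) i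
    · simp
    · simpa using hts i

/-- Every critical monomial is the monomial of largest weight of some element of the ideal,
simultaneously for all weakly decreasing weights. -/
theorem exists_mem_idealI_of_mem_critAt [CharZero K] {M : Type*} [AddCommMonoid M] [LinearOrder M]
    [IsOrderedAddMonoid M] {n : ℕ} {m : ℕ → ℕ} {k : ℕ} (hk : 1 ≤ k) {φ : Fin n → M}
    (hφ : Antitone φ) {j : Fin n} {s : Fin n →₀ ℕ} (hs : s ∈ critAt m k n j) :
    ∃ f ∈ idealI K m k n, MvPolynomial.coeff s f = 1 ∧ SuppWeightLE φ (∑ i, s i • φ i) f := by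
  induction n generalizing m k with
  | zero => exact j.elim0
  | succ n ih =>
    obtain ⟨p, s, rfl⟩ : ∃ p s', s = Finsupp.cons p s' := ⟨s 0, s.tail, by simp⟩
    have hsum : ∑ i : Fin (n + 1), (MvPolynomial.X i : MvPolynomial (Fin (n + 1)) K) =
        MvPolynomial.X 0 + MvPolynomial.rename Fin.succ (∑ i : Fin n, MvPolynomial.X i) := by
      rw [Fin.sum_univ_succ]; simp
    have hpm : p < m 0 := (isMFree_cons.1 hs.1.1).1
    refine Fin.cases (fun hs => ?_) (fun j hs => ?_) j hs
    · obtain rfl : s = 0 := by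
        ext i
        simpa using hs.2.1 i.succ (Fin.succ_pos i)
      -- Criticality at the first index forces p = k; the element is the k-th power of the sum of
      -- the variables, expanded binomially.
      have hpk := (mem_critBar_iff.1 hs.1).2.2
      simp only [Fin.val_zero, padZero_cons_zero, Finset.range_zero, Finset.sum_empty, topDegree,
        mul_zero, add_zero, Nat.cast_inj] at hpk
      subst hpk
      have h := coeff_and_weight_of_glue hφ (p := p) (s := (0 : Fin n →₀ ℕ))
        (g := (1 : MvPolynomial (Fin n) K)) (by simp)
        ((SuppWeightLE.one _).mono (by simp)) (c := fun i => (p.choose i : K)) (by simp)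
      refine ⟨_, ?_, h⟩
      convert sum_pow_mem_idealI m p (n + 1) using 1
      rw [hsum, add_pow]
      refine Finset.sum_congr rfl fun i _ => ?_
      rw [Nat.cast_smul_eq_nsmul, nsmul_eq_mul]
      simp [mul_comm]
    -- Otherwise x_1^k would be an earlier critical divisor.
    · have hpk : p < k := by
        have h := (forall_not_le_critBar_iff hk hs.1.1 (j.succ)).1
          (fun l hl => hs.2.2 l (Fin.lt_def.2 hl)) 0 (by omega) (by simp)
        simpa [padZero_cons_zero, topDegree] using h
      obtain ⟨g, hgI, hg, hgw⟩ := ih (m := fun i => m (i + 1)) (k := k + m 0 - 1 - 2 * p)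
        (by omega) (hφ.comp_monotone (Fin.strictMono_succ).monotone) (tail_mem_critAt hpk hpm hs)
      obtain ⟨c, hcp, hc⟩ := exists_binaryForm_mem (K := K) hpk hpm
      refine ⟨_, ?_, coeff_and_weight_of_glue hφ hg hgw hcp⟩
      -- Modulo the pure powers, `g` is h L^(k + m_0 - 1 - 2p). Each term of h times the binary form
      -- contains this factor, and replacing it by `g` changes the result only by multiples of pure
      -- powers.
      obtain ⟨u, hu, v, hv, rfl⟩ := Submodule.mem_sup.1 hgI
      obtain ⟨h, rfl⟩ := Ideal.mem_span_singleton'.1 hv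
      set L : MvPolynomial (Fin n) K := ∑ i, MvPolynomial.X i
      have hform := hc (MvPolynomial.X 0 : MvPolynomial (Fin (n + 1)) K)
        (MvPolynomial.rename Fin.succ L)
      have hle : Ideal.span {(MvPolynomial.X 0 : MvPolynomial (Fin (n + 1)) K) ^ m 0,
          (MvPolynomial.X 0 + MvPolynomial.rename Fin.succ L) ^ k} ≤ idealI K m k (n + 1) := by
        rw [Ideal.span_le, ← hsum]
        rintro _ (rfl | rfl)
        · exact X_pow_mem_idealI m k (0 : Fin (n + 1))
        · exact sum_pow_mem_idealI m k (n + 1)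
      have hform := Ideal.mul_mem_left _ (MvPolynomial.rename Fin.succ h) (hle hform)
      rw [Finset.mul_sum] at hform
      have hP := rename_succ_mem_idealI (k := k) hu
      convert Ideal.add_mem _ hform (Ideal.sum_mem _ (t := Finset.range (p + 1)) fun i _ =>
        Ideal.mul_mem_left _ (c i • (MvPolynomial.X 0 ^ i *
          MvPolynomial.rename Fin.succ (L ^ (p - i)))) hP) using 1
      rw [← Finset.sum_add_distrib]
      refine Finset.sum_congr rfl fun i hi => ?_
      have hi := Finset.mem_range.1 hi
      rw [show k + m 0 - 1 - p - i = (p - i) + (k + m 0 - 1 - 2 * p) by omega]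
      simp only [map_mul, map_add, map_pow, pow_add, Algebra.smul_def]
      ring

end LeadingElements

/-! ### The Hilbert function of the ideal of pure powers. -/

section MonomialIdeals

variable {K : Type*} [Field K]

lemma monomial_eq_smul_one {σ : Type*} (s : σ →₀ ℕ) (a : K) :
    MvPolynomial.monomial s a = a • MvPolynomial.monomial s 1 := by
  rw [MvPolynomial.smul_monomial, smul_eq_mul, mul_one]

lemma mem_idealP_iff {m : ℕ → ℕ} {n : ℕ} {f : MvPolynomial (Fin n) K} :
    f ∈ idealP K m n ↔ ∀ s ∈ f.support, ¬ IsMFree m s := by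
  have h : (Set.range fun i : Fin n => (MvPolynomial.X i : MvPolynomial (Fin n) K) ^ m i) =
      (fun s => MvPolynomial.monomial s (1 : K)) ''
        (Set.range fun i : Fin n => Finsupp.single i (m i)) := by
    rw [← Set.range_comp]
    refine congrArg _ (funext fun i => ?_)
    simp [MvPolynomial.X_pow_eq_monomial]
  rw [idealP, h, MvPolynomial.mem_ideal_span_monomial_image]
  refine forall₂_congr fun s _ => ?_
  simp [IsMFree]

lemma monomial_mem_idealP {m : ℕ → ℕ} {n : ℕ} {s : Fin n →₀ ℕ} (hs : ¬ IsMFree m s) (a : K) :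
    MvPolynomial.monomial s a ∈ idealP K m n := by
  rw [mem_idealP_iff]
  intro t ht
  rwa [Finset.mem_singleton.1 (MvPolynomial.support_monomial_subset ht)]

/-- The finset of `m`-free monomials of degree `e`. -/
noncomputable def freeMonomialsOfDegree (m : ℕ → ℕ) (n : ℕ) (e : ℤ) : Finset (Fin n →₀ ℕ) :=
  {s ∈ freeMonomials m n | (s.degree : ℤ) = e}

lemma mem_freeMonomialsOfDegree {m : ℕ → ℕ} {n : ℕ} {e : ℤ} {s : Fin n →₀ ℕ} :
    s ∈ freeMonomialsOfDegree m n e ↔ IsMFree m s ∧ (s.degree : ℤ) = e := by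
  simp [freeMonomialsOfDegree]

/-- The coefficients of a polynomial at the `m`-free monomials of degree `e`. -/
noncomputable def freeCoeffs (K : Type*) [Field K] (m : ℕ → ℕ) (n : ℕ) (e : ℤ) :
    MvPolynomial (Fin n) K →ₗ[K] (freeMonomialsOfDegree m n e → K) :=
  LinearMap.pi fun s => MvPolynomial.lcoeff K (s : Fin n →₀ ℕ)

@[simp] lemma freeCoeffs_apply (m : ℕ → ℕ) (n : ℕ) (e : ℤ) (f : MvPolynomial (Fin n) K)
    (s : freeMonomialsOfDegree m n e) :
    freeCoeffs K m n e f s = MvPolynomial.coeff (s : Fin n →₀ ℕ) f := rfl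

lemma freeCoeffs_eq_zero_of_mem_idealP {m : ℕ → ℕ} {n : ℕ} (e : ℤ) {f : MvPolynomial (Fin n) K}
    (hf : f ∈ idealP K m n) : freeCoeffs K m n e f = 0 := by
  ext s
  by_contra h
  exact mem_idealP_iff.1 hf s (MvPolynomial.mem_support_iff.2 h)
    (mem_freeMonomialsOfDegree.1 s.2).1

lemma freeCoeffs_eq_zero_of_isHomogeneous (m : ℕ → ℕ) {n : ℕ} {e : ℤ} {d : ℕ} (hde : (d : ℤ) ≠ e)
    {f : MvPolynomial (Fin n) K} (hf : f.IsHomogeneous d) : freeCoeffs K m n e f = 0 := by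
  ext s
  refine hf.coeff_eq_zero fun h => hde ?_
  rw [← h]
  exact (mem_freeMonomialsOfDegree.1 s.2).2

lemma freeCoeffs_surjOn_homogeneous (m : ℕ → ℕ) (n d : ℕ) :
    Function.Surjective
      (freeCoeffs K m n d ∘ₗ (MvPolynomial.homogeneousSubmodule (Fin n) K d).subtype) := by
  classical
  intro w
  refine ⟨⟨∑ s : freeMonomialsOfDegree m n d, MvPolynomial.monomial (s : Fin n →₀ ℕ) (w s),
    Submodule.sum_mem _ fun s _ => ?_⟩, ?_⟩
  · rw [MvPolynomial.mem_homogeneousSubmodule]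
    exact MvPolynomial.isHomogeneous_monomial _
      (by exact_mod_cast (mem_freeMonomialsOfDegree.1 s.2).2)
  · ext t
    simp [MvPolynomial.coeff_sum, MvPolynomial.coeff_monomial]

lemma hilbertFunction_idealP (m : ℕ → ℕ) (n : ℕ) (e : ℤ) :
    hilbertFunction (idealP K m n) e = freeCount m n e := by
  rw [hilbertFunction]
  split_ifs with he
  · lift e to ℕ using he
    set ψ := (Ideal.Quotient.mkₐ K (idealP K m n)).toLinearMap ∘ₗ
      (MvPolynomial.homogeneousSubmodule (Fin n) K e).subtype with hψ
    have hrange : quotientComponent (idealP K m n) e = LinearMap.range ψ := by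
      rw [hψ, LinearMap.range_comp, Submodule.range_subtype, quotientComponent]
    have hker : LinearMap.ker ψ = LinearMap.ker
        (freeCoeffs K m n e ∘ₗ (MvPolynomial.homogeneousSubmodule (Fin n) K e).subtype) := by
      ext ⟨f, hf⟩
      simp only [hψ, LinearMap.mem_ker, LinearMap.comp_apply, Submodule.subtype_apply,
        AlgHom.toLinearMap_apply, Ideal.Quotient.mkₐ_eq_mk, Ideal.Quotient.eq_zero_iff_mem]
      refine ⟨freeCoeffs_eq_zero_of_mem_idealP _, fun h => mem_idealP_iff.2 fun s hs hfree => ?_⟩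
      refine MvPolynomial.mem_support_iff.1 hs (congrFun h ⟨s, mem_freeMonomialsOfDegree.2
        ⟨hfree, ?_⟩⟩)
      by_contra hd
      exact MvPolynomial.mem_support_iff.1 hs
        (((MvPolynomial.mem_homogeneousSubmodule e f).1 hf).coeff_eq_zero
          fun h => hd (by exact_mod_cast h))
    rw [Int.toNat_natCast, hrange, ← ψ.quotKerEquivRange.finrank_eq,
      ((Submodule.quotEquivOfEq _ _ hker).trans (LinearMap.quotKerEquivOfSurjective _
        (freeCoeffs_surjOn_homogeneous m n e))).finrank_eq, Module.finrank_fintype_fun_eq_card,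
      Fintype.card_coe]
    rfl
  · rw [freeCount, eq_comm, Finset.card_eq_zero, Finset.filter_eq_empty_iff]
    intro s _ hs
    omega

end MonomialIdeals

/-! ### Initial ideals and Macaulay's theorem. -/

section InitialIdeals

variable {K : Type*} [Field K] {σ : Type*}

/-- Initial monomials of elements of `I` are already closed under multiplication by monomials. -/
lemma monomial_mem_initialIdeal_iff {ord : MonomialOrder σ} {I : Ideal (MvPolynomial σ K)}
    {t : σ →₀ ℕ} : MvPolynomial.monomial t (1 : K) ∈ initialIdeal ord I ↔
      ∃ f ∈ I, f ≠ 0 ∧ ord.degree f = t := by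
  classical
  have h : {p : MvPolynomial σ K | ∃ f ∈ I, f ≠ 0 ∧ p = MvPolynomial.monomial (ord.degree f) 1} =
      (fun s => MvPolynomial.monomial s (1 : K)) '' {s | ∃ f ∈ I, f ≠ 0 ∧ ord.degree f = s} := by
    ext p
    constructor
    · rintro ⟨f, hf, h0, rfl⟩
      exact ⟨_, ⟨f, hf, h0, rfl⟩, rfl⟩
    · rintro ⟨_, ⟨f, hf, h0, rfl⟩, rfl⟩
      exact ⟨f, hf, h0, rfl⟩
  rw [initialIdeal, h, MvPolynomial.mem_ideal_span_monomial_image, MvPolynomial.support_monomial,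
    if_neg one_ne_zero]
  constructor
  · intro ht
    obtain ⟨_, ⟨f, hf, h0, rfl⟩, hle⟩ := ht t (Finset.mem_singleton_self t)
    have hmon : MvPolynomial.monomial (t - ord.degree f) (1 : K) ≠ 0 := by simp
    refine ⟨MvPolynomial.monomial (t - ord.degree f) 1 * f, I.mul_mem_left _ hf,
      mul_ne_zero hmon h0, ?_⟩
    rw [MonomialOrder.degree_mul hmon h0, MonomialOrder.degree_monomial, if_neg one_ne_zero,
      tsub_add_cancel_of_le hle]
  · rintro ht s hs
    exact ⟨t, ht, (Finset.mem_singleton.1 hs).ge⟩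

lemma monomial_mem_initialIdeal_of_le {ord : MonomialOrder σ} {I : Ideal (MvPolynomial σ K)}
    {s t : σ →₀ ℕ} (hs : MvPolynomial.monomial s (1 : K) ∈ initialIdeal ord I) (hst : s ≤ t) :
    MvPolynomial.monomial t (1 : K) ∈ initialIdeal ord I := by
  have h : MvPolynomial.monomial t (1 : K) =
      MvPolynomial.monomial (t - s) 1 * MvPolynomial.monomial s 1 := by
    rw [MvPolynomial.monomial_mul, tsub_add_cancel_of_le hst, one_mul]
  rw [h]
  exact Ideal.mul_mem_left _ _ hs

lemma monomial_mem_initialIdeal_of_mem {ord : MonomialOrder σ} {I : Ideal (MvPolynomial σ K)}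
    {t : σ →₀ ℕ} (ht : MvPolynomial.monomial t (1 : K) ∈ I) :
    MvPolynomial.monomial t (1 : K) ∈ initialIdeal ord I := by
  classical
  refine monomial_mem_initialIdeal_iff.2 ⟨_, ht, by simp, ?_⟩
  rw [MonomialOrder.degree_monomial, if_neg one_ne_zero]

/-- Macaulay's theorem: the monomials outside the initial ideal span the quotient. -/
lemma span_monomials_sup_eq_top (ord : MonomialOrder σ) (I : Ideal (MvPolynomial σ K)) :
    Submodule.span K {p | ∃ t, MvPolynomial.monomial t (1 : K) ∉ initialIdeal ord I ∧
      p = MvPolynomial.monomial t 1} ⊔ I.restrictScalars K = ⊤ := by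
  classical
  set W := Submodule.span K {p | ∃ t, MvPolynomial.monomial t (1 : K) ∉ initialIdeal ord I ∧
      p = MvPolynomial.monomial t 1} ⊔ I.restrictScalars K with hW
  -- Well-founded induction along the order: a monomial of the initial ideal is rewritten, modulo
  -- `I`, in lower ones.
  have hmon : ∀ a : ord.syn, ∀ t, ord.toSyn t = a → MvPolynomial.monomial t (1 : K) ∈ W := by
    intro a
    induction a using WellFoundedLT.induction with
    | ind a ih =>
      rintro t rfl
      by_cases ht : MvPolynomial.monomial t (1 : K) ∈ initialIdeal ord I
      · obtain ⟨f, hf, h0, rfl⟩ := monomial_mem_initialIdeal_iff.1 ht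
        have hlc : MvPolynomial.coeff (ord.degree f) f ≠ 0 :=
          ord.coeff_degree_ne_zero_iff.2 h0
        have hsum := MvPolynomial.support_sum_monomial_coeff f
        rw [← Finset.add_sum_erase _ _ (ord.degree_mem_support h0)] at hsum
        have hlow : ∑ s ∈ f.support.erase (ord.degree f),
            MvPolynomial.monomial s (MvPolynomial.coeff s f) ∈ W := by
          refine Submodule.sum_mem _ fun s hs => ?_
          obtain ⟨hne, hs⟩ := Finset.mem_erase.1 hs
          rw [monomial_eq_smul_one]
          exact Submodule.smul_mem _ _ (ih _ (lt_of_le_of_ne (ord.le_degree hs)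
            fun h => hne (ord.toSyn.injective h)) s rfl)
        have hfW : f ∈ W := Submodule.mem_sup_right hf
        rw [← hsum] at hfW
        have hlead := (Submodule.add_mem_iff_left _ hlow).1 hfW
        rw [monomial_eq_smul_one] at hlead
        exact (Submodule.smul_mem_iff _ hlc).1 hlead
      · exact Submodule.mem_sup_left (Submodule.subset_span ⟨t, ht, rfl⟩)
  refine eq_top_iff.2 fun f _ => ?_
  rw [← MvPolynomial.support_sum_monomial_coeff f]
  refine Submodule.sum_mem _ fun s _ => ?_
  rw [monomial_eq_smul_one]
  exact Submodule.smul_mem _ _ (hmon _ s rfl)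

end InitialIdeals

/-! ### Homogeneity of the ideal. -/

section Homogeneity

variable {K : Type*} [Field K]

lemma isHomogeneous_sum_X (n : ℕ) :
    (∑ i : Fin n, (MvPolynomial.X i : MvPolynomial (Fin n) K)).IsHomogeneous 1 :=
  MvPolynomial.IsHomogeneous.sum _ _ _ fun i _ => MvPolynomial.isHomogeneous_X K i

lemma homogeneousComponent_mem_idealI {m : ℕ → ℕ} {k n : ℕ} {f : MvPolynomial (Fin n) K}
    (hf : f ∈ idealI K m k n) (d : ℕ) : MvPolynomial.homogeneousComponent d f ∈ idealI K m k n := by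
  let _ := MvPolynomial.gradedAlgebra (σ := Fin n) (R := K)
  refine MvPolynomial.homogeneousComponent_mem_of_mem (Ideal.IsHomogeneous.sup ?_ ?_) hf d
  · refine Ideal.homogeneous_span _ _ ?_
    rintro _ ⟨i, rfl⟩
    exact ⟨1 * m i, (MvPolynomial.isHomogeneous_X K i).pow (m i)⟩
  · refine Ideal.homogeneous_span _ _ ?_
    rintro _ rfl
    exact ⟨1 * k, (isHomogeneous_sum_X n).pow k⟩

end Homogeneity

/-! ### The initial ideal of I_n, by comparing counts. -/

section InitialIdealOfPowers

variable {K : Type*} [Field K]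

-- The forms of degree d modulo P_n are spanned by the monomials outside the initial ideal together
-- with the products of L^k and the `m`-free monomials of degree d - k.
open Classical in
lemma freeCount_le (m : ℕ → ℕ) (k n d : ℕ) (ord : MonomialOrder (Fin n)) :
    freeCount m n d ≤ Finset.card {s ∈ freeMonomialsOfDegree m n d |
      MvPolynomial.monomial s (1 : K) ∉ initialIdeal ord (idealI K m k n)}
      + freeCount m n (d - k) := by
  set T := {s ∈ freeMonomialsOfDegree m n d |
      MvPolynomial.monomial s (1 : K) ∉ initialIdeal ord (idealI K m k n)}
  set L : MvPolynomial (Fin n) K := ∑ i, MvPolynomial.X i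
  let v : T ⊕ freeMonomialsOfDegree m n (d - k) → (freeMonomialsOfDegree m n d → K) :=
    Sum.elim (fun s => freeCoeffs K m n d (MvPolynomial.monomial (s : Fin n →₀ ℕ) 1))
      (fun s => freeCoeffs K m n d (MvPolynomial.monomial (s : Fin n →₀ ℕ) 1 * L ^ k))
  have hmul : ∀ h : MvPolynomial (Fin n) K,
      freeCoeffs K m n d (h * L ^ k) ∈ Submodule.span K (Set.range v) := by
    intro h
    induction h using MvPolynomial.induction_on' with
    | monomial u a =>
      rw [monomial_eq_smul_one, smul_mul_assoc, map_smul]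
      refine Submodule.smul_mem _ _ ?_
      by_cases hu : IsMFree m u
      · by_cases hd : (u.degree : ℤ) = d - k
        · exact Submodule.subset_span ⟨Sum.inr ⟨u, mem_freeMonomialsOfDegree.2 ⟨hu, hd⟩⟩, rfl⟩
        · rw [freeCoeffs_eq_zero_of_isHomogeneous m (d := u.degree + 1 * k)
            (by push_cast; omega)
            ((MvPolynomial.isHomogeneous_monomial _ rfl).mul ((isHomogeneous_sum_X n).pow k))]
          exact Submodule.zero_mem _
      · rw [freeCoeffs_eq_zero_of_mem_idealP _
          (Ideal.mul_mem_right _ _ (monomial_mem_idealP hu 1))]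
        exact Submodule.zero_mem _
    | add p q hp hq => rw [add_mul, map_add]; exact Submodule.add_mem _ hp hq
  have hspan : Submodule.span K (Set.range v) = ⊤ := by
    have hsurj : LinearMap.range (freeCoeffs K m n d) = ⊤ := LinearMap.range_eq_top.2
      (Function.Surjective.of_comp (freeCoeffs_surjOn_homogeneous (K := K) m n d))
    rw [eq_top_iff, ← hsurj, LinearMap.range_eq_map,
      ← span_monomials_sup_eq_top ord (idealI K m k n), Submodule.map_le_iff_le_comap, sup_le_iff,
      Submodule.span_le]
    constructor
    · rintro _ ⟨t, ht, rfl⟩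
      rw [SetLike.mem_coe, Submodule.mem_comap]
      have hfree : IsMFree m t := by
        by_contra h
        exact ht (monomial_mem_initialIdeal_of_mem (Ideal.mem_sup_left (monomial_mem_idealP h 1)))
      by_cases hd : (t.degree : ℤ) = d
      · exact Submodule.subset_span ⟨Sum.inl ⟨t, Finset.mem_filter.2
          ⟨mem_freeMonomialsOfDegree.2 ⟨hfree, hd⟩, ht⟩⟩, rfl⟩
      · rw [freeCoeffs_eq_zero_of_isHomogeneous m hd (MvPolynomial.isHomogeneous_monomial _ rfl)]
        exact Submodule.zero_mem _
    · intro f hf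
      obtain ⟨u, hu, w, hw, rfl⟩ := Submodule.mem_sup.1 hf
      obtain ⟨h, rfl⟩ := Ideal.mem_span_singleton'.1 hw
      rw [Submodule.mem_comap, map_add, freeCoeffs_eq_zero_of_mem_idealP _ hu, zero_add]
      exact hmul h
  have := finrank_le_of_span_eq_top hspan
  rwa [Module.finrank_fintype_fun_eq_card, Fintype.card_sum, Fintype.card_coe, Fintype.card_coe,
    Fintype.card_coe] at this

/-- A monomial order is itself a weight with values in `ord.syn`, so the weight bounds identify
initial monomials. -/
lemma toSyn_eq_sum {n : ℕ} (ord : MonomialOrder (Fin n)) (s : Fin n →₀ ℕ) :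
    ord.toSyn s = ∑ i, s i • ord.toSyn (Finsupp.single i 1) := by
  conv_lhs => rw [← Finsupp.univ_sum_single s]
  rw [map_sum]
  refine Finset.sum_congr rfl fun i _ => ?_
  rw [← map_nsmul, Finsupp.smul_single, smul_eq_mul, mul_one]

variable [CharZero K]

lemma monomial_mem_initialIdeal_of_mem_crit {m : ℕ → ℕ} {k n : ℕ} (hk : 1 ≤ k)
    {ord : MonomialOrder (Fin n)}
    (hord : ∀ i j : Fin n, i < j → Finsupp.single j 1 ≺[ord] Finsupp.single i 1)
    {s : Fin n →₀ ℕ} (hs : s ∈ crit m k n) :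
    MvPolynomial.monomial s (1 : K) ∈ initialIdeal ord (idealI K m k n) := by
  obtain ⟨j, hj⟩ := Set.mem_iUnion.1 hs
  have hφ : Antitone fun i : Fin n => ord.toSyn (Finsupp.single i 1) :=
    StrictAnti.antitone fun i j h => hord i j h
  obtain ⟨f, hf, hcoeff, hw⟩ := exists_mem_idealI_of_mem_critAt (K := K) hk hφ hj
  have hs : s ∈ f.support := by rw [MvPolynomial.mem_support_iff, hcoeff]; exact one_ne_zero
  refine monomial_mem_initialIdeal_iff.2 ⟨f, hf, ?_, ?_⟩
  · rintro rfl; simp at hs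
  · refine ord.toSyn.injective (le_antisymm (ord.degree_le_iff.2 fun t ht => ?_) (ord.le_degree hs))
    rw [toSyn_eq_sum, toSyn_eq_sum]
    exact hw t ht

/-- The monomials outside the initial ideal of `I_{n,m,k}` are the standard monomials. -/
theorem monomial_mem_initialIdeal_idealI_iff {m : ℕ → ℕ} (hm : ∀ i, 2 ≤ m i) {k n : ℕ} (hk : 1 ≤ k)
    {ord : MonomialOrder (Fin n)}
    (hord : ∀ i j : Fin n, i < j → Finsupp.single j 1 ≺[ord] Finsupp.single i 1)
    {s : Fin n →₀ ℕ} :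
    MvPolynomial.monomial s (1 : K) ∈ initialIdeal ord (idealI K m k n) ↔ ¬ IsStandard m k s := by
  classical
  have hnot : ∀ s : Fin n →₀ ℕ, ¬ IsStandard m k s →
      MvPolynomial.monomial s (1 : K) ∈ initialIdeal ord (idealI K m k n) := by
    intro s hs
    by_cases hfree : IsMFree m s
    · rw [isStandard_iff_forall_crit hk] at hs
      push Not at hs
      obtain ⟨t, ht, hts⟩ := hs hfree
      exact monomial_mem_initialIdeal_of_le (monomial_mem_initialIdeal_of_mem_crit hk hord ht) hts
    · exact monomial_mem_initialIdeal_of_mem (Ideal.mem_sup_left (monomial_mem_idealP hfree 1))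
  refine ⟨fun hs hstd => ?_, hnot s⟩
  set d := s.degree with hd
  set T := {s ∈ freeMonomialsOfDegree m n d |
      MvPolynomial.monomial s (1 : K) ∉ initialIdeal ord (idealI K m k n)}
  set S := {s ∈ freeMonomials m n | IsStandard m k s ∧ (s.degree : ℤ) = d}
  have hTS : T ⊆ S := by
    intro t ht
    obtain ⟨h1, h2⟩ := Finset.mem_filter.1 ht
    obtain ⟨h3, h4⟩ := mem_freeMonomialsOfDegree.1 h1
    exact Finset.mem_filter.2 ⟨mem_freeMonomials.2 h3, by_contra fun h => h2 (hnot t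
      fun h' => h ⟨h', h4⟩)⟩
  -- The construction gives T ⊆ S; the lower bound `freeCount_le` meets the exact value of
  -- `stdCount`, so the two sets coincide.
  have hcard : S.card ≤ T.card := by
    have h1 : (S.card : ℤ) = _ := stdCount_eq hm hk n d
    have h2 : freeCount m n d ≤ T.card + freeCount m n (d - k) := by
      convert freeCount_le (K := K) m k n d ord
    split_ifs at h1 with h
    · omega
    · omega
  have hsS : s ∈ S := Finset.mem_filter.2 ⟨mem_freeMonomials.2 hstd.1, hstd, rfl⟩
  rw [← Finset.eq_of_subset_of_card_le hTS hcard] at hsS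
  exact (Finset.mem_filter.1 hsS).2 hs

end InitialIdealOfPowers

/-! ### The socle degree through standard monomials. -/

section SocleDegree

variable {K : Type*} [Field K] [CharZero K]

lemma stdCount_pos_iff {m : ℕ → ℕ} {k n : ℕ} {e : ℤ} :
    0 < stdCount m k n e ↔ ∃ s : Fin n →₀ ℕ, IsStandard m k s ∧ (s.degree : ℤ) = e := by
  classical
  rw [stdCount, Finset.card_pos]
  constructor
  · rintro ⟨s, hs⟩
    exact ⟨s, (Finset.mem_filter.1 hs).2⟩
  · rintro ⟨s, hs⟩
    exact ⟨s, Finset.mem_filter.2 ⟨mem_freeMonomials.2 hs.1.1, hs⟩⟩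

lemma quotientComponent_idealI_ne_bot_iff {m : ℕ → ℕ} (hm : ∀ i, 2 ≤ m i) {k n : ℕ} (hk : 1 ≤ k)
    {ord : MonomialOrder (Fin n)}
    (hord : ∀ i j : Fin n, i < j → Finsupp.single j 1 ≺[ord] Finsupp.single i 1) (d : ℕ) :
    quotientComponent (idealI K m k n) d ≠ ⊥ ↔ 0 < stdCount m k n d := by
  have hbot : quotientComponent (idealI K m k n) d = ⊥ ↔
      ∀ f : MvPolynomial (Fin n) K, f.IsHomogeneous d → f ∈ idealI K m k n := by
    rw [quotientComponent, eq_bot_iff, Submodule.map_le_iff_le_comap]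
    refine forall₂_congr fun f _ => ?_
    simp [Ideal.Quotient.eq_zero_iff_mem]
  rw [stdCount_pos_iff, Ne, hbot, ← not_iff_not, not_not]
  constructor
  · rintro h ⟨s, hs, hsd⟩
    exact (monomial_mem_initialIdeal_idealI_iff hm hk hord).1 (monomial_mem_initialIdeal_of_mem
      (h _ (MvPolynomial.isHomogeneous_monomial (1 : K) (by exact_mod_cast hsd)))) hs
  · intro h f hf
    have hmem : f ∈ (⊤ : Submodule K (MvPolynomial (Fin n) K)) := Submodule.mem_top
    rw [← span_monomials_sup_eq_top ord (idealI K m k n)] at hmem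
    obtain ⟨w, hw, g, hg, rfl⟩ := Submodule.mem_sup.1 hmem
    -- `w` is a combination of standard monomials, none of degree `d`; the form is then the
    -- degree-`d` part of an element of the homogeneous ideal.
    have hw0 : MvPolynomial.homogeneousComponent d w = 0 := by
      have hle : Submodule.span K {p | ∃ t, MvPolynomial.monomial t (1 : K) ∉
          initialIdeal ord (idealI K m k n) ∧ p = MvPolynomial.monomial t 1} ≤
          LinearMap.ker (MvPolynomial.homogeneousComponent (R := K) (σ := Fin n) d) := by
        rw [Submodule.span_le]
        rintro _ ⟨t, ht, rfl⟩
        rw [monomial_mem_initialIdeal_idealI_iff hm hk hord, not_not] at ht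
        rw [SetLike.mem_coe, LinearMap.mem_ker,
          MvPolynomial.homogeneousComponent_of_mem (n := t.degree)
            (MvPolynomial.isHomogeneous_monomial _ rfl),
          if_neg fun hd => h ⟨t, ht, by exact_mod_cast hd.symm⟩]
      exact hle hw
    rw [← MvPolynomial.homogeneousComponent_eq_self hf, map_add, hw0, zero_add]
    exact homogeneousComponent_mem_idealI hg d

lemma isStandard_zero {m : ℕ → ℕ} (hm : ∀ i, 2 ≤ m i) {k : ℕ} (hk : 1 ≤ k) (n : ℕ) :
    IsStandard m k (0 : Fin n →₀ ℕ) := by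
  have h0 : ∀ i, padZero (0 : Fin n →₀ ℕ) i = 0 := fun i => by simp [padZero]
  refine ⟨fun i => by have := hm i; simp; omega, fun j _ => ?_⟩
  have := (topDegree_strictMono hm).monotone (Nat.zero_le j)
  simp only [h0, Nat.cast_zero, Finset.sum_const_zero, mul_zero, add_zero]
  simp only [topDegree, Finset.range_zero, Finset.sum_empty] at this ⊢
  omega

/-- The socle degree is the largest degree of a standard monomial. -/
lemma socleDegree_idealI_spec {m : ℕ → ℕ} (hm : ∀ i, 2 ≤ m i) {k n : ℕ} (hk : 1 ≤ k)
    {ord : MonomialOrder (Fin n)}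
    (hord : ∀ i j : Fin n, i < j → Finsupp.single j 1 ≺[ord] Finsupp.single i 1) :
    0 < stdCount m k n (socleDegree (idealI K m k n)) ∧
      ∀ d : ℕ, 0 < stdCount m k n d → d ≤ socleDegree (idealI K m k n) := by
  have hset : {d : ℕ | quotientComponent (idealI K m k n) d ≠ ⊥} =
      {d : ℕ | 0 < stdCount m k n d} :=
    Set.ext fun d => quotientComponent_idealI_ne_bot_iff hm hk hord d
  have hbdd : BddAbove {d : ℕ | 0 < stdCount m k n d} := by
    refine ⟨(topDegree m n + k).toNat, fun d hd => ?_⟩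
    have := two_mul_lt_of_stdCount_pos hm hk hd
    omega
  rw [socleDegree, hset]
  refine ⟨Nat.sSup_mem (s := {d : ℕ | 0 < stdCount m k n d}) ⟨0, ?_⟩ hbdd,
    fun d hd => le_csSup hbdd hd⟩
  exact stdCount_pos_iff.2 ⟨0, isStandard_zero hm hk n, by simp⟩

end SocleDegree

/-! ### Reduced Gröbner bases of homogeneous ideals. -/

section ReducedGroebnerBasis

variable {K : Type*} [Field K] {σ : Type*} {ord : MonomialOrder σ} {I : Ideal (MvPolynomial σ K)}
  {G : Finset (MvPolynomial σ K)}

lemma IsReducedGroebnerBasis.monomial_mem_iff (hG : IsReducedGroebnerBasis ord I G) {t : σ →₀ ℕ} :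
    MvPolynomial.monomial t (1 : K) ∈ initialIdeal ord I ↔ ∃ g ∈ G, ord.degree g ≤ t := by
  classical
  have h : {p : MvPolynomial σ K | ∃ g ∈ G, p = MvPolynomial.monomial (ord.degree g) 1} =
      (fun s => MvPolynomial.monomial s (1 : K)) '' {s | ∃ g ∈ G, ord.degree g = s} := by
    ext p
    constructor
    · rintro ⟨g, hg, rfl⟩
      exact ⟨_, ⟨g, hg, rfl⟩, rfl⟩
    · rintro ⟨_, ⟨g, hg, rfl⟩, rfl⟩
      exact ⟨g, hg, rfl⟩
  rw [hG.generates, h, MvPolynomial.mem_ideal_span_monomial_image, MvPolynomial.support_monomial,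
    if_neg one_ne_zero]
  simp

/-- Subtracting the homogeneous component of the initial monomial leaves an element of `I` supported
on the tail of `g`; were it nonzero, its initial monomial would contradict reducedness. -/
lemma IsReducedGroebnerBasis.isHomogeneous (hG : IsReducedGroebnerBasis ord I G)
    (hI : ∀ f ∈ I, ∀ d, MvPolynomial.homogeneousComponent d f ∈ I) {g : MvPolynomial σ K}
    (hg : g ∈ G) : g.IsHomogeneous (ord.degree g).degree := by
  set d := (ord.degree g).degree with hd
  have hmem : g - MvPolynomial.homogeneousComponent d g ∈ I :=
    I.sub_mem (hG.mem g hg).1 (hI g (hG.mem g hg).1 d)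
  by_cases h0 : g - MvPolynomial.homogeneousComponent d g = 0
  · rw [sub_eq_zero.1 h0]
    exact MvPolynomial.homogeneousComponent_isHomogeneous d g
  · exfalso
    have hin := (monomial_mem_initialIdeal_iff (ord := ord)).2 ⟨_, hmem, h0, rfl⟩
    have hsupp := ord.degree_mem_support h0
    set t := ord.degree (g - MvPolynomial.homogeneousComponent d g)
    rw [MvPolynomial.mem_support_iff, MvPolynomial.coeff_sub,
      MvPolynomial.coeff_homogeneousComponent] at hsupp
    by_cases htd : t.degree = d
    · simp [htd] at hsupp
    · rw [if_neg htd, sub_zero] at hsupp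
      exact hG.tail g hg t (MvPolynomial.mem_support_iff.2 hsupp) (fun h => htd (by rw [h])) hin

end ReducedGroebnerBasis

/-! ### Basis elements versus critical monomials, and the formula. -/

section Main

variable {K : Type*} [Field K] {m : ℕ → ℕ} {k n : ℕ} {ord : MonomialOrder (Fin n)}
  {G : Finset (MvPolynomial (Fin n) K)}

lemma totalDegree_of_mem (hG : IsReducedGroebnerBasis ord (idealI K m k n) G)
    {g : MvPolynomial (Fin n) K} (hg : g ∈ G) : g.totalDegree = (ord.degree g).degree :=
  (hG.isHomogeneous (fun _ hf d => homogeneousComponent_mem_idealI hf d) hg).totalDegree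
    (hG.mem g hg).2

variable [CharZero K]

/-- The `m`-free initial monomials of the reduced Gröbner basis are the critical monomials. -/
lemma ncard_groebner_eq_critCount (hm : ∀ i, 2 ≤ m i) (hk : 1 ≤ k)
    (hord : ∀ i j : Fin n, i < j → Finsupp.single j 1 ≺[ord] Finsupp.single i 1)
    (hG : IsReducedGroebnerBasis ord (idealI K m k n) G) (d : ℕ) :
    {g | g ∈ G ∧ IsMFree m (ord.degree g) ∧ g.totalDegree = d}.ncard = critCount m k n d := by
  rw [critCount]
  refine Set.ncard_congr (fun g _ => ord.degree g) ?_ ?_ ?_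
  · rintro g ⟨hg, hfree, rfl⟩
    refine ⟨?_, (totalDegree_of_mem hG hg).symm⟩
    have hin : MvPolynomial.monomial (ord.degree g) (1 : K) ∈ initialIdeal ord (idealI K m k n) :=
      hG.monomial_mem_iff.2 ⟨g, hg, le_rfl⟩
    rw [monomial_mem_initialIdeal_idealI_iff hm hk hord, isStandard_iff_forall_crit hk] at hin
    push Not at hin
    obtain ⟨t, ht, htg⟩ := hin hfree
    obtain ⟨g', hg', hle⟩ := hG.monomial_mem_iff.1
      (monomial_mem_initialIdeal_of_mem_crit (K := K) hk hord ht)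
    have heq := hG.minimal g hg g' hg' (hle.trans htg)
    rw [heq] at hle
    rwa [le_antisymm hle htg]
  · rintro g g' ⟨hg, -⟩ ⟨hg', -⟩ h
    exact hG.minimal g' hg' g hg h.le
  · rintro s ⟨hs, rfl⟩
    obtain ⟨g, hg, hle⟩ := hG.monomial_mem_iff.1
      (monomial_mem_initialIdeal_of_mem_crit (K := K) hk hord hs)
    have hfree : IsMFree m s := by
      obtain ⟨j, hj⟩ := Set.mem_iUnion.1 hs
      exact hj.1.1
    have hin : MvPolynomial.monomial (ord.degree g) (1 : K) ∈ initialIdeal ord (idealI K m k n) :=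
      hG.monomial_mem_iff.2 ⟨g, hg, le_rfl⟩
    rw [monomial_mem_initialIdeal_idealI_iff hm hk hord, isStandard_iff_forall_crit hk] at hin
    push Not at hin
    obtain ⟨t, ht, htg⟩ := hin (hfree.of_le hle)
    -- The critical monomial `t` divides the initial monomial of `g`, which divides `s`; the
    -- antichain property collapses the chain.
    have hts := crit_antichain hs ht (htg.trans hle)
    have heq : ord.degree g = s := le_antisymm hle (hts ▸ htg)
    exact ⟨g, ⟨hg, heq ▸ hfree, by rw [totalDegree_of_mem hG hg, heq]⟩, heq⟩

lemma stdCount_pos_of_mem_critAt (hm : ∀ i, 2 ≤ m i) (hk : 1 ≤ k) {j : Fin n} {s : Fin n →₀ ℕ}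
    (hs : s ∈ critAt m k n j) : 0 < stdCount m k j (topDegree m j + k - s.degree) := by
  obtain ⟨h1, h2, -, -, h5⟩ := (mem_critAt_iff hm hk).1 hs
  have := degree_of_forall_gt h1
  exact stdCount_pos_iff.2 ⟨_, h2, by omega⟩

/-- The least degree of a critical monomial in `n + 1` variables is complementary to the socle
degree in `n` variables. -/
lemma isLeast_degree_critAt_last (hm : ∀ i, 2 ≤ m i) (hk : 1 ≤ k)
    (hord : ∀ i j : Fin n, i < j → Finsupp.single j 1 ≺[ord] Finsupp.single i 1) {ε : ℕ}
    (hε : IsLeast (Finsupp.degree '' critAt m k (n + 1) (Fin.last n)) ε) :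
    (ε : ℤ) = topDegree m n + k - socleDegree (idealI K m k n) := by
  obtain ⟨hδ, hmax⟩ := socleDegree_idealI_spec (K := K) hm hk hord
  set δ := socleDegree (idealI K m k n)
  have hδ2 := two_mul_lt_of_stdCount_pos hm hk hδ
  obtain ⟨⟨s, hs, hsε⟩, hmin⟩ := hε
  have hdeg := degree_mem_of_mem_critAt hm hk hs
  have hpos := stdCount_pos_of_mem_critAt hm hk hs
  rw [Fin.val_last] at hdeg hpos
  obtain ⟨t, -, ht⟩ := stdCount_pos_iff.1 hpos
  have hle := hmax t.degree (by rwa [ht])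
  -- This degree lies in the window of index n: the strict bound on δ gives the lower end, and d ≤
  -- ε, from the prefix `t` of degree at most δ, gives the upper end.
  obtain ⟨d, hd⟩ : ∃ d : ℕ, (d : ℤ) = topDegree m n + k - δ :=
    ⟨(topDegree m n + k - δ : ℤ).toNat, Int.toNat_of_nonneg (by omega)⟩
  have hcard := ncard_critAt_degree (n := n + 1) (j := Fin.last n) hm hk (d := d)
    (by rw [Fin.val_last]; omega) (by rw [Fin.val_last]; omega)
  rw [Fin.val_last, show topDegree m n + k - d = δ by omega] at hcard
  obtain ⟨u, hu, hud⟩ := Set.nonempty_of_ncard_ne_zero (by rw [hcard]; exact hδ.ne')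
  have := hmin ⟨u, hu, hud⟩
  omega

end Main

theorem mainTheorem7 {K : Type*} [Field K] [CharZero K]
    (m : ℕ → ℕ) (hm : ∀ i, 2 ≤ m i) (k : ℕ) (hk : 1 ≤ k)
    -- for every `n`, a monomial order on `K[x_1, …, x_n]` with `x_1 ≻ ⋯ ≻ x_n`
    (ord : ∀ n : ℕ, MonomialOrder (Fin n))
    (hord : ∀ (n : ℕ) (i j : Fin n), i < j →
      Finsupp.single j 1 ≺[ord n] Finsupp.single i 1)
    -- `G n` is the reduced Gröbner basis `G_{n,m,k}` of `I_{n,m,k}`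
    (G : ∀ n : ℕ, Finset (MvPolynomial (Fin n) K))
    (hG : ∀ n, IsReducedGroebnerBasis (ord n) (idealI K m k n) (G n)) :
    -- (i) the number of variables (here `n = q + 1`) is determined by `d`
    (∀ d q₁ q₂ : ℕ, k ≤ d →
      (∃ g ∈ G (q₁ + 1), g.totalDegree = d ∧
        (ord (q₁ + 1)).degree g ∈ critAt m k (q₁ + 1) (Fin.last q₁)) →
      (∃ g ∈ G (q₂ + 1), g.totalDegree = d ∧
        (ord (q₂ + 1)).degree g ∈ critAt m k (q₂ + 1) (Fin.last q₂)) →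
      q₁ + 1 = q₂ + 1) ∧
    -- the sequence `g_{m,k}` is well defined: the counts are eventually constant in `n`
    (∀ d : ℕ, k ≤ d → ∀ᶠ n in Filter.atTop, critCount m k n d = gSeq m k d) ∧
    -- (ii) the counting formula, with `n = q + 1`
    (∀ d q : ℕ, k ≤ d →
      (∃ g ∈ G (q + 1), g.totalDegree = d ∧
        (ord (q + 1)).degree g ∈ critAt m k (q + 1) (Fin.last q)) →
      ∀ (ε : ℕ) (γ : ℤ),
        IsLeast (Finsupp.degree '' critAt m k (q + 1) (Fin.last q)) ε →
        γ = (d : ℤ) - ε →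
        (∀ N : ℕ, q + 1 ≤ N →
          {g | g ∈ G N ∧ IsMFree m ((ord N).degree g) ∧ g.totalDegree = d}.ncard
            = gSeq m k d) ∧
        (gSeq m k d : ℤ) =
          max 0 ((hilbertFunction (idealP K m q) (socleDegree (idealI K m k q) - γ) : ℤ)
            - hilbertFunction (idealP K m q) (socleDegree (idealI K m k q) - γ - k))) := by
  have hidx : ∀ d q : ℕ, (∃ g ∈ G (q + 1), g.totalDegree = d ∧
      (ord (q + 1)).degree g ∈ critAt m k (q + 1) (Fin.last q)) →
      (topDegree m q + k < 2 * d ∧ 2 * (d : ℤ) ≤ topDegree m (q + 1) + k) := by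
    rintro d q ⟨g, hg, rfl, hs⟩
    rw [totalDegree_of_mem (hG _) hg]
    exact degree_mem_of_mem_critAt hm hk hs
  refine ⟨fun d q₁ q₂ _ h₁ h₂ => ?_, fun d hd => ?_, fun d q _ hq ε γ hε hγ => ⟨fun N hN => ?_, ?_⟩⟩
  · rw [critAt_index_unique hm (hidx d q₁ h₁) (hidx d q₂ h₂)]
  · obtain ⟨q, hq⟩ := exists_critAt_index hm hk hd
    filter_upwards [Filter.eventually_ge_atTop (q + 1)] with n hn
    rw [critCount_eq hm hk hq hn, gSeq_eq hm hk hq]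
  · rw [ncard_groebner_eq_critCount hm hk (hord N) (hG N), critCount_eq hm hk (hidx d q hq) hN,
      gSeq_eq hm hk (hidx d q hq)]
  -- With ε = T_q + k - δ, the degree δ - γ equals T_q + k - d, the degree of the prefixes being
  -- counted.
  · have hε' := isLeast_degree_critAt_last (K := K) hm hk (hord q) hε
    rw [gSeq_eq hm hk (hidx d q hq), stdCount_eq_max hm hk, hilbertFunction_idealP,
      hilbertFunction_idealP, show (socleDegree (idealI K m k q) : ℤ) - γ = topDegree m q + k - d by
        rw [hγ]; linarith]
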